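/- Let $M$ be a smooth manifold, $A\to M$ a Lie algebroid with anchor $\rho$, and $V\to M$ a representation of $A$, i.e. a vector bundle with a flat $A$-connection $\nabla^A$. Let $\nabla$ be any connection on the vector bundle $V$, with curvature $R^\nabla$ and exterior covariant derivative $d^\nabla$ on $\Omega^\bullet(M;V)$. For $p,q\ge 0$ let $W^{p,q}(A;V)$ be the set of Weil cochains: sequences $c=(c_0,\dots,c_p)$, where $c_k(\alpha_1,\dots,\alpha_{p-k}\|\beta_1,\dots,\beta_k)\in\Omega^{q-k}(M;V)$ (zero if $k>q$) is $\mathbb R$-multilinear and alternating in $\alpha_i\in\Gamma(A)$, $C^\infty(M)$-multilinear and symmetric in $\beta_j\in\Gamma(A)$, and $$c_k(f\alpha_1,\alpha_2,\dots\|\underline\beta)=f\,c_k(\alpha_1,\alpha_2,\dots\|\underline\beta)+df\wedge c_{k+1}(\alpha_2,\dots\|\alpha_1,\underline\beta)\qquad(f\in C^\infty(M)).$$ $W^{p,q}(A;N)$ is defined likewise for any vector bundle $N$. Let $\delta$ be the simplicial differential $$\begin{aligned}(-1)^k(\delta c)_k(\alpha_0,\dots,\alpha_{p-k}\|\underline\beta)={}&\sum_i(-1)^i\mathcal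 L^A_{\alpha_i}\big(c_k(\alpha_0,\dots,\widehat{\alpha_i},\dots,\alpha_{p-k}\|\cdot)\big)(\underline\beta)\\&+\sum_{i<j}(-1)^{i+j}c_k([\alpha_i,\alpha_j],\dots,\widehat{\alpha_i},\dots,\widehat{\alpha_j},\dots\|\underline\beta)-\sum_{j=1}^k\iota_{\rho(\beta_j)}c_{k-1}(\underline\alpha\|\beta_1,\dots,\widehat{\beta_j},\dots,\beta_k),\end{aligned}$$ where $$(\mathcal L^A_\alpha\gamma)(\underline\beta)(\underline X)=\nabla^A_\alpha\big(\gamma(\underline\beta)(\underline X)\big)-\sum_i\gamma(\dots,[\alpha,\beta_i],\dots)(\underline X)-\sum_j\gamma(\underline\beta)(\dots,[\rho(\alpha),X_j],\dots),$$ and let $d^\nabla$ act on Weil cochains by $$(-1)^k(d^\nabla c)_k(\underline\alpha\|\underline\beta)=d^\nabla\big(c_k(\underline\alpha\|\underline\beta)\big)-\sum_{i=1}^kc_{k-1}(\beta_i,\underline\alpha\|\beta_1,\dots,\widehat{\beta_i},\dots,\beta_k).$$ Put $\theta(\alpha)=\nabla^A_\alpha-\nabla_{\rho(\alpha)}\in\Gamma(\operatorname{End}V)$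 and $T(\alpha)=d^\nabla\theta(\alpha)-\iota_{\rho(\alpha)}R^\nabla\in\Omega^1(M;\operatorname{End}V)$, with the induced connection on $\operatorname{End}V$, and for a Weil cochain $c\in W^{p,q}(A;V)$ put $$\big((T,\theta)\wedge c\big)_k(\alpha_0,\dots,\alpha_{p-k}\|\underline\beta)=\sum_{i=0}^{p-k}(-1)^iT(\alpha_i)\wedge c_k(\alpha_0,\dots,\widehat{\alpha_i},\dots,\alpha_{p-k}\|\underline\beta)+\sum_{j=1}^k\theta(\beta_j)\cdot c_{k-1}(\underline\alpha\|\beta_1,\dots,\widehat{\beta_j},\dots,\beta_k).$$ Then: 1. $d^\nabla$, $\delta$ and $(T,\theta)\wedge\cdot$ map $W^{p,q}(A;V)$ to $W^{p,q+1}(A;V)$, $W^{p+1,q}(A;V)$ and $W^{p+1,q+1}(A;V)$ respectively, and $(T,\theta)\in W^{1,1}(A;\operatorname{End}V)$. 2. For all $p,q\ge0$ and $c\in W^{p,q}(A;V)$, $\;d^\nabla\delta c-\delta d^\nabla c=(T,\theta)\wedge c$. 3. $d^\nabla$ is a cochain map (that is, $d^\nabla\delta c=\delta d^\nabla c$ for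 all $p,q\ge0$ and $c\in W^{p,q}(A;V)$) if and only if $\nabla$ is $A$-invariant: $\nabla^A_\alpha=\nabla_{\rho(\alpha)}$ and $\iota_{\rho(\alpha)}R^\nabla=0$ for all $\alpha\in\Gamma(A)$. 4. If $\nabla$ is $A$-invariant, then $d^\nabla$ maps infinitesimal multiplicative forms ($c\in W^{1,q}(A;V)$ with $\delta c=0$) to infinitesimal multiplicative forms. -/

import Mathlib

open Bundle
open scoped Manifold ContDiff

noncomputable section

namespace LieAlgebroidWeil

section Geometry

variable {E : Type*} [NormedAddCommGroup E] [NormedSpace ℝ E]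
  {H : Type*} [TopologicalSpace H] {I : ModelWithCorners ℝ E H}
  {M : Type*} [TopologicalSpace M] [ChartedSpace H M]
  {F : Type*} [NormedAddCommGroup F] [NormedSpace ℝ F]
  {V : M → Type*} [TopologicalSpace (TotalSpace F V)] [∀ x, TopologicalSpace (V x)]
  [∀ x, AddCommGroup (V x)] [∀ x, Module ℝ (V x)] [FiberBundle F V] [VectorBundle ℝ F V]

/-- Pointwise multiplication of smooth sections by smooth functions. -/
instance sectionSMul : SMul C^∞⟮I, M; ℝ⟯ Cₛ^∞⟮I; F, V⟯ :=
  ⟨fun f s => ⟨fun x => f x • s x, f.contMDiff.smul_section s.contMDiff⟩⟩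

@[simp]
theorem smul_section_apply (f : C^∞⟮I, M; ℝ⟯) (s : Cₛ^∞⟮I; F, V⟯) (x : M) :
    (f • s) x = f x • s x := rfl

/-- The `C^∞(M)`-module of smooth sections of a vector bundle. -/
instance sectionModule : Module C^∞⟮I, M; ℝ⟯ Cₛ^∞⟮I; F, V⟯ where
  one_smul s := by ext x; exact one_smul ℝ (s x)
  mul_smul f g s := by ext x; exact mul_smul (f x) (g x) (s x)
  smul_zero f := by ext x; exact smul_zero (f x)
  smul_add f s t := by ext x; exact smul_add (f x) (s x) (t x)
  add_smul f g s := by ext x; exact add_smul (f x) (g x) (s x)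
  zero_smul s := by ext x; exact zero_smul ℝ (s x)

instance sectionSMulComm : SMulCommClass C^∞⟮I, M; ℝ⟯ ℝ Cₛ^∞⟮I; F, V⟯ :=
  ⟨fun f r s => by ext x; exact smul_comm (f x) r (s x)⟩

/-- Smooth vector fields. -/
abbrev VField {E : Type*} [NormedAddCommGroup E] [NormedSpace ℝ E]
    {H : Type*} [TopologicalSpace H] (I : ModelWithCorners ℝ E H)
    (M : Type*) [TopologicalSpace M] [ChartedSpace H M] [IsManifold I ∞ M] : Type _ :=
  Cₛ^∞⟮I; E, (TangentSpace I : M → Type _)⟯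

variable [IsManifold I ∞ M]

/-- The derivative `X f` of a smooth function along a vector field. -/
def dirDeriv (X : VField I M) (f : C^∞⟮I, M; ℝ⟯) : C^∞⟮I, M; ℝ⟯ :=
  ⟨fun x => mvfderiv I f x (X x), by
    have h1 : ContMDiff I.tangent (𝓘(ℝ, ℝ).tangent) ∞ (tangentMap I 𝓘(ℝ, ℝ) f) :=
      f.contMDiff.contMDiff_tangentMap (m := ∞) (by simp)
    exact (contMDiff_snd_tangentBundle_modelSpace ℝ 𝓘(ℝ, ℝ)).comp (h1.comp X.contMDiff)⟩

theorem dirDeriv_apply (X : VField I M) (f : C^∞⟮I, M; ℝ⟯) (x : M) :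
    dirDeriv X f x = mvfderiv I f x (X x) := rfl

variable [FiniteDimensional ℝ E]

/-- The Lie bracket of vector fields. -/
def vbracket (X Y : VField I M) : VField I M :=
  ⟨VectorField.mlieBracket I X Y, by
    have : CompleteSpace E := FiniteDimensional.complete ℝ E
    have : IsManifold I (minSmoothness ℝ 2) M := by
      rw [minSmoothness_of_isRCLikeNormedField]; infer_instance
    have : IsManifold I (((⊤ : ℕ∞) : ℕ∞ω) + 1) M := ‹IsManifold I ∞ M›
    exact ContDiff.mlieBracket_vectorField (n := ⊤) (m := ⊤) X.contMDiff Y.contMDiff (by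
      rw [minSmoothness_of_isRCLikeNormedField]; exact le_rfl)⟩

theorem vbracket_dirDeriv (X Y : VField I M) (f : C^∞⟮I, M; ℝ⟯) :
    dirDeriv (vbracket X Y) f = dirDeriv X (dirDeriv Y f) - dirDeriv Y (dirDeriv X f) := by
  have : CompleteSpace E := FiniteDimensional.complete ℝ E
  have : IsManifold I (minSmoothness ℝ 2) M := by
    rw [minSmoothness_of_isRCLikeNormedField]; infer_instance
  have : IsManifold I (minSmoothness ℝ 3) M := by
    rw [minSmoothness_of_isRCLikeNormedField]; infer_instance
  ext x
  change mvfderiv I f x (VectorField.mlieBracket I X Y x) =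
    mvfderiv I (dirDeriv Y f) x (X x) - mvfderiv I (dirDeriv X f) x (Y x)
  by_cases hE : Nontrivial E
  swap
  · have hs : Subsingleton E := not_nontrivial_iff_subsingleton.mp hE
    have hz : ∀ v : TangentSpace I x, v = 0 := fun v => Subsingleton.elim (α := E) v 0
    rw [hz (VectorField.mlieBracket I X Y x), hz (X x), hz (Y x)]
    simp
  obtain ⟨w, hw⟩ := exists_ne (0 : E)
  let W : Π y : M, TangentSpace I y := FiberBundle.extend E (show TangentSpace I x from w)
  have hWx : W x = w := FiberBundle.extend_apply_self ..
  have h22 : minSmoothness ℝ 2 = 2 := minSmoothness_of_isRCLikeNormedField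
  have hX : ∀ y, ContMDiffAt I (I.prod 𝓘(ℝ, E)) 2 (fun y => TotalSpace.mk' E y (X y)) y :=
    fun y => (X.contMDiff y).of_le (by norm_cast)
  have hY : ∀ y, ContMDiffAt I (I.prod 𝓘(ℝ, E)) 2 (fun y => TotalSpace.mk' E y (Y y)) y :=
    fun y => (Y.contMDiff y).of_le (by norm_cast)
  have hW : ContMDiffAt I (I.prod 𝓘(ℝ, E)) 2 (fun y => TotalSpace.mk' E y (W y)) x :=
    FiberBundle.contMDiffAt_extend ..
  have hf : ContMDiffAt I 𝓘(ℝ, ℝ) 2 f x := (f.contMDiff x).of_le (by norm_cast)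
  have hfd : ∀ (g : C^∞⟮I, M; ℝ⟯) (y : M), MDifferentiableAt I 𝓘(ℝ, ℝ) g y :=
    fun g y => (g.contMDiff y).mdifferentiableAt (by simp)
  have hWev : ∀ᶠ y in nhds x, MDifferentiableAt I (I.prod 𝓘(ℝ, E))
      (fun y => TotalSpace.mk' E y (W y)) y := by
    have hW' := contMDiffAt_iff_contMDiffAt_nhds (by simp) |>.1 hW
    filter_upwards [hW'] with y hy using ContMDiffAt.mdifferentiableAt hy (by simp)
  have hWd := hWev.self_of_nhds
  -- the bracket of a vector field with `f W`, near `x`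
  have key : ∀ Z : VField I M, VectorField.mlieBracket I Z ((f : M → ℝ) • W) =ᶠ[nhds x]
      (dirDeriv Z f : M → ℝ) • W + (f : M → ℝ) • VectorField.mlieBracket I Z W := by
    intro Z
    filter_upwards [hWev] with y hy
    exact VectorField.mlieBracket_smul_right (hfd f y) hy
  have hbr : ∀ Z : VField I M, MDifferentiableAt I (I.prod 𝓘(ℝ, E))
      (fun y => TotalSpace.mk' E y (VectorField.mlieBracket I Z W y)) x := by
    intro Z
    have : IsManifold I (((2 : ℕ∞) : ℕ∞ω) + 1) M := by
      rw [show (((2 : ℕ∞) : ℕ∞ω) + 1) = 3 by norm_cast]; infer_instance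
    refine (ContMDiffAt.mlieBracket_vectorField (n := 2) (m := 1) ?_ ?_ ?_).mdifferentiableAt
      (by simp)
    · exact (Z.contMDiff x).of_le (by norm_cast)
    · exact hW
    · rw [minSmoothness_of_isRCLikeNormedField]; norm_cast
  have hfW : ContMDiffAt I (I.prod 𝓘(ℝ, E)) 2
      (fun y => TotalSpace.mk' E y (((f : M → ℝ) • W) y)) x := hf.smul_section hW
  have exp : ∀ Z Z' : VField I M,
      VectorField.mlieBracket I Z (VectorField.mlieBracket I Z' ((f : M → ℝ) • W)) x =
      mvfderiv I (dirDeriv Z' f) x (Z x) • W x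
      + mvfderiv I f x (Z' x) • VectorField.mlieBracket I Z W x
      + (mvfderiv I f x (Z x) • VectorField.mlieBracket I Z' W x
        + f x • VectorField.mlieBracket I Z (VectorField.mlieBracket I Z' W) x) := by
    intro Z Z'
    have e1 := Filter.EventuallyEq.mlieBracket_vectorField_eq (I := I)
      (Filter.EventuallyEq.refl (nhds x) (Z : Π y, TangentSpace I y)) (key Z')
    rw [e1, VectorField.mlieBracket_add_right ((hfd _ x).smul_section hWd)
        ((hfd _ x).smul_section (hbr Z')),
      VectorField.mlieBracket_smul_right (hfd _ x) hWd,
      VectorField.mlieBracket_smul_right (hfd _ x) (hbr Z')]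
    rfl
  have J1 := VectorField.leibniz_identity_mlieBracket_apply (I := I)
    (h22 ▸ hX x) (h22 ▸ hY x) (h22 ▸ hfW)
  have J2 := VectorField.leibniz_identity_mlieBracket_apply (I := I)
    (h22 ▸ hX x) (h22 ▸ hY x) (h22 ▸ hW)
  have e3 := VectorField.mlieBracket_smul_right (I := I) (V := VectorField.mlieBracket I X Y)
    (hfd f x) hWd
  rw [exp, exp, e3, J2] at J1
  have h0 : (mvfderiv I f x (VectorField.mlieBracket I X Y x) -
      (mvfderiv I (dirDeriv Y f) x (X x) - mvfderiv I (dirDeriv X f) x (Y x))) • W x = 0 := by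
    rw [sub_smul, sub_smul]
    generalize mvfderiv I f x (VectorField.mlieBracket I X Y x) • W x = t at *
    have J3 := sub_eq_zero.mpr J1
    rw [← neg_eq_zero, ← J3]
    module
  rcases smul_eq_zero.mp h0 with h | h
  · exact sub_eq_zero.mp h
  · exact absurd (hWx.symm.trans h) hw

end Geometry

section Connection

variable {E : Type*} [NormedAddCommGroup E] [NormedSpace ℝ E]
  {H : Type*} [TopologicalSpace H] {I : ModelWithCorners ℝ E H}
  {M : Type*} [TopologicalSpace M] [ChartedSpace H M] [IsManifold I ∞ M]
  {FV : Type*} [NormedAddCommGroup FV] [NormedSpace ℝ FV]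
  {V : M → Type*} [TopologicalSpace (TotalSpace FV V)] [∀ x, TopologicalSpace (V x)]
  [∀ x, AddCommGroup (V x)] [∀ x, Module ℝ (V x)]
  [∀ x, IsTopologicalAddGroup (V x)] [∀ x, ContinuousSMul ℝ (V x)]
  [FiberBundle FV V] [VectorBundle ℝ FV V]
  (nab : CovariantDerivative I FV V) [nab.ContMDiffCovariantDerivative ∞]

/-- The section `∇_X σ`, for a smooth connection `∇`. -/
def covSec (X : VField I M) (s : Cₛ^∞⟮I; FV, V⟯) : Cₛ^∞⟮I; FV, V⟯ :=
  ⟨fun x => nab s x (X x), by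
    have h := (CovariantDerivative.ContMDiffCovariantDerivative.contMDiff (cov := nab)
      (k := ∞)).contMDiff (σ := s) s.contMDiff.contMDiffOn
    exact (contMDiffOn_univ.1 h).clm_bundle_apply X.contMDiff⟩

theorem covSec_add (X : VField I M) (s t : Cₛ^∞⟮I; FV, V⟯) :
    covSec nab X (s + t) = covSec nab X s + covSec nab X t := by
  ext x
  exact congrArg (fun φ => φ (X x))
    (nab.isCovariantDerivativeOnUniv.add (s.mdifferentiableAt) (t.mdifferentiableAt))

theorem covSec_leibniz (X : VField I M) (f : C^∞⟮I, M; ℝ⟯) (s : Cₛ^∞⟮I; FV, V⟯) :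
    covSec nab X (f • s) = f • covSec nab X s + dirDeriv X f • s := by
  ext x
  have h := nab.isCovariantDerivativeOnUniv.leibniz (g := f) (x := x) (s.mdifferentiableAt)
    ((f.contMDiff x).mdifferentiableAt (by simp))
  exact congrArg (fun φ => φ (X x)) h

/-- The connection induced on `End V`, `(∇_X φ) σ = ∇_X (φ σ) - φ (∇_X σ)`; sections of `End V` are
regarded as `C^∞(M)`-linear endomorphisms of `Γ(V)`. -/
def endCov (X : VField I M) (φ : Module.End C^∞⟮I, M; ℝ⟯ Cₛ^∞⟮I; FV, V⟯) :
    Module.End C^∞⟮I, M; ℝ⟯ Cₛ^∞⟮I; FV, V⟯ where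
  toFun s := covSec nab X (φ s) - φ (covSec nab X s)
  map_add' s t := by simp only [covSec_add, map_add]; abel
  map_smul' f s := by
    simp only [covSec_leibniz, map_add, map_smul, RingHom.id_apply]
    module

variable [FiniteDimensional ℝ E]

/-- The curvature `R^∇(X, Y) = ∇_X ∇_Y - ∇_Y ∇_X - ∇_{[X,Y]}`. -/
def curvature (X Y : VField I M) : Module.End C^∞⟮I, M; ℝ⟯ Cₛ^∞⟮I; FV, V⟯ where
  toFun s := covSec nab X (covSec nab Y s) - covSec nab Y (covSec nab X s)
    - covSec nab (vbracket X Y) s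
  map_add' s t := by simp only [covSec_add]; abel
  map_smul' f s := by
    simp only [covSec_leibniz, covSec_add, vbracket_dirDeriv, RingHom.id_apply]
    module

end Connection

section Algebroid

variable {E : Type*} [NormedAddCommGroup E] [NormedSpace ℝ E]
  {H : Type*} [TopologicalSpace H] {I : ModelWithCorners ℝ E H}
  {M : Type*} [TopologicalSpace M] [ChartedSpace H M] [IsManifold I ∞ M]
  {FA : Type*} [NormedAddCommGroup FA] [NormedSpace ℝ FA]
  {A : M → Type*} [TopologicalSpace (TotalSpace FA A)] [∀ x, TopologicalSpace (A x)]
  [∀ x, AddCommGroup (A x)] [∀ x, Module ℝ (A x)]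
  [FiberBundle FA A] [VectorBundle ℝ FA A]

/-- The vector field `ρ(α)`, for a smooth bundle map `ρ : A → TM` and a section `α` of `A`. -/
def applyAnchor (rho : Cₛ^∞⟮I; FA →L[ℝ] E, fun x : M => A x →L[ℝ] TangentSpace I x⟯)
    (a : Cₛ^∞⟮I; FA, A⟯) : VField I M :=
  ⟨fun x => rho x (a x), rho.contMDiff.clm_bundle_apply a.contMDiff⟩

variable [FiniteDimensional ℝ E]

variable (I FA A) in
/-- A Lie algebroid structure on the vector bundle `A → M`: a smooth bundle map `ρ : A → TM`, the
anchor, and a Lie bracket on `Γ(A)` that satisfies the Leibniz rule and that the anchor preserves. -/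
structure LieAlgebroid where
  anchor : Cₛ^∞⟮I; FA →L[ℝ] E, fun x : M => A x →L[ℝ] TangentSpace I x⟯
  bracket : Cₛ^∞⟮I; FA, A⟯ →ₗ[ℝ] Cₛ^∞⟮I; FA, A⟯ →ₗ[ℝ] Cₛ^∞⟮I; FA, A⟯
  bracket_self : ∀ a, bracket a a = 0
  jacobi : ∀ a b c, bracket a (bracket b c) = bracket (bracket a b) c + bracket b (bracket a c)
  leibniz : ∀ (a b : Cₛ^∞⟮I; FA, A⟯) (f : C^∞⟮I, M; ℝ⟯),
    bracket a (f • b) = f • bracket a b + dirDeriv (applyAnchor anchor a) f • b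
  anchor_bracket : ∀ a b, applyAnchor anchor (bracket a b) =
    vbracket (applyAnchor anchor a) (applyAnchor anchor b)

/-- The anchor of a Lie algebroid on sections. -/
def LieAlgebroid.rho (L : LieAlgebroid I FA A) (a : Cₛ^∞⟮I; FA, A⟯) : VField I M :=
  applyAnchor L.anchor a

variable {FV : Type*} [NormedAddCommGroup FV] [NormedSpace ℝ FV]
  {V : M → Type*} [TopologicalSpace (TotalSpace FV V)] [∀ x, TopologicalSpace (V x)]
  [∀ x, AddCommGroup (V x)] [∀ x, Module ℝ (V x)]
  [FiberBundle FV V] [VectorBundle ℝ FV V]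

variable (FV V) in
/-- A representation of a Lie algebroid on a vector bundle `V → M`: a flat `A`-connection `∇^A`. -/
structure AlgebroidRep (L : LieAlgebroid I FA A) where
  act : Cₛ^∞⟮I; FA, A⟯ →ₗ[ℝ] Cₛ^∞⟮I; FV, V⟯ →ₗ[ℝ] Cₛ^∞⟮I; FV, V⟯
  smul_left : ∀ (f : C^∞⟮I, M; ℝ⟯) a s, act (f • a) s = f • act a s
  leibniz : ∀ a (f : C^∞⟮I, M; ℝ⟯) s, act a (f • s) = f • act a s + dirDeriv (L.rho a) f • s
  flat : ∀ a b s, act (L.bracket a b) s = act a (act b s) - act b (act a s)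

end Algebroid

/-! ### Alternating sums, forms and Weil cochains -/

section Sums

variable {S N : Type*} [AddCommGroup N]

/-- The sum `∑ᵢ (-1)ⁱ F(xᵢ; x₀, …, x̂ᵢ, …, xₘ)`. -/
def altSum {m : ℕ} (F : S → (Fin m → S) → N) (x : Fin (m + 1) → S) : N :=
  ∑ i : Fin (m + 1), (-1 : ℤ) ^ (i : ℕ) • F (x i) (i.removeNth x)

/-- The sum `∑_{i < j} (-1)^{i+j} f([xᵢ, xⱼ], x₀, …, x̂ᵢ, …, x̂ⱼ, …, xₘ)`. The index `i < j` is
taken in `Fin (m + 1)`, so that it also names the position of `xᵢ` once `xⱼ` is removed. -/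
def bracketSum (br : S → S → S) : {m : ℕ} → ((Fin m → S) → N) → (Fin (m + 1) → S) → N
  | 0, _, _ => 0
  | m + 1, f, x => ∑ j : Fin (m + 2), ∑ i : Fin (m + 1),
      if i.castSucc < j then
        (-1 : ℤ) ^ ((i : ℕ) + (j : ℕ)) •
          f (Fin.cons (br (x i.castSucc) (x j)) (i.removeNth (j.removeNth x)))
      else 0

/-- The map `f` of `m` arguments is alternating and `R`-multilinear. -/
def IsAlternating (R : Type*) [CommRing R] [AddCommGroup S] [Module R S] [Module R N] {m : ℕ}
    (f : (Fin m → S) → N) : Prop :=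
  ∃ g : S [⋀^Fin m]→ₗ[R] N, ⇑g = f

/-- The map `f` of `m` arguments is symmetric and `R`-multilinear. -/
def IsSymmetric (R : Type*) [CommRing R] [AddCommGroup S] [Module R S] [Module R N] {m : ℕ}
    (f : (Fin m → S) → N) : Prop :=
  (∃ g : MultilinearMap R (fun _ : Fin m => S) N, ⇑g = f) ∧
    ∀ (e : Equiv.Perm (Fin m)) (x : Fin m → S), f (x ∘ e) = f x

end Sums

/-- The type of sequences `c = (c_0, …, c_p)` of maps `c_k(α ‖ β)(X)` of `a = p - k` arguments
`α`, of `k` arguments `β` and of `m = q - k` arguments `X`. There is no component with `k > p` or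
`k > q`: such a `c_k` is zero. -/
abbrev WeilSeq (S T N : Type*) (p q : ℕ) : Type _ :=
  ∀ a k m : ℕ, a + k = p → k + m = q → (Fin a → S) → (Fin k → S) → (Fin m → T) → N

section Weil

variable {E : Type*} [NormedAddCommGroup E] [NormedSpace ℝ E]
  {H : Type*} [TopologicalSpace H] {I : ModelWithCorners ℝ E H}
  {M : Type*} [TopologicalSpace M] [ChartedSpace H M] [IsManifold I ∞ M]
  {FA : Type*} [NormedAddCommGroup FA] [NormedSpace ℝ FA]
  {A : M → Type*} [TopologicalSpace (TotalSpace FA A)] [∀ x, TopologicalSpace (A x)]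
  [∀ x, AddCommGroup (A x)] [∀ x, Module ℝ (A x)]
  [FiberBundle FA A] [VectorBundle ℝ FA A]
  {N : Type*} [AddCommGroup N] [Module ℝ N] [Module C^∞⟮I, M; ℝ⟯ N]

/-- The component `(df ∧ c_{k+1})(α ‖ β)` in form degree `m = q - k`; it vanishes for `m = 0`. -/
def dWedgeNext {p q : ℕ} (f : C^∞⟮I, M; ℝ⟯) (c : WeilSeq Cₛ^∞⟮I; FA, A⟯ (VField I M) N p q)
    (a k : ℕ) : ∀ m : ℕ, a + (k + 1) = p → k + m = q →
      (Fin a → Cₛ^∞⟮I; FA, A⟯) → (Fin (k + 1) → Cₛ^∞⟮I; FA, A⟯) → (Fin m → VField I M) → N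
  | 0, _, _, _, _, _ => 0
  | m + 1, ha, hm, α, β, X =>
      altSum (fun Y X' => dirDeriv Y f • c a (k + 1) m ha (by omega) α β X') X

/-- The sequence `c` is a Weil cochain of bidegree `(p, q)`. The coefficients are the sections of a
vector bundle, given as a `C^∞(M)`-module `N`, and differential forms with these coefficients are
alternating `C^∞(M)`-multilinear maps from vector fields to `N`. -/
structure IsWeilCochain {p q : ℕ} (c : WeilSeq Cₛ^∞⟮I; FA, A⟯ (VField I M) N p q) : Prop where
  form : ∀ a k m ha hm α β, IsAlternating C^∞⟮I, M; ℝ⟯ (c a k m ha hm α β)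
  symm : ∀ a k m ha hm α X, IsSymmetric C^∞⟮I, M; ℝ⟯ (fun β => c a k m ha hm α β X)
  alt : ∀ a k m ha hm β X, IsAlternating ℝ (fun α => c a k m ha hm α β X)
  leibniz : ∀ a k m (ha : a + 1 + k = p) (hm : k + m = q) (f : C^∞⟮I, M; ℝ⟯) (α₀ : Cₛ^∞⟮I; FA, A⟯)
    (α : Fin a → Cₛ^∞⟮I; FA, A⟯) (β : Fin k → Cₛ^∞⟮I; FA, A⟯) (X : Fin m → VField I M),
    c (a + 1) k m ha hm (Fin.cons (f • α₀) α) β X =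
      f • c (a + 1) k m ha hm (Fin.cons α₀ α) β X +
        dWedgeNext f c a k m (by omega) hm α (Fin.cons α₀ β) X

variable [FiniteDimensional ℝ E]
  {FV : Type*} [NormedAddCommGroup FV] [NormedSpace ℝ FV]
  {V : M → Type*} [TopologicalSpace (TotalSpace FV V)] [∀ x, TopologicalSpace (V x)]
  [∀ x, AddCommGroup (V x)] [∀ x, Module ℝ (V x)]
  [FiberBundle FV V] [VectorBundle ℝ FV V]

/-! The simplicial differential. -/

section Simplicial

variable {L : LieAlgebroid I FA A} (R : AlgebroidRep FV V L)

/-- The Lie derivative `𝓛^A_α` on `Ω^m(M; S^k(A^*) ⊗ V)`. -/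
def lieDer (α : Cₛ^∞⟮I; FA, A⟯) {k m : ℕ}
    (γ : (Fin k → Cₛ^∞⟮I; FA, A⟯) → (Fin m → VField I M) → Cₛ^∞⟮I; FV, V⟯)
    (β : Fin k → Cₛ^∞⟮I; FA, A⟯) (X : Fin m → VField I M) : Cₛ^∞⟮I; FV, V⟯ :=
  R.act α (γ β X) - ∑ i, γ (Function.update β i (L.bracket α (β i))) X
    - ∑ j, γ β (Function.update X j (vbracket (L.rho α) (X j)))

/-- The first two sums in `(-1)^k (δ c)_k`. -/
def deltaKoszul {p q : ℕ} (c : WeilSeq Cₛ^∞⟮I; FA, A⟯ (VField I M) Cₛ^∞⟮I; FV, V⟯ p q) :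
    WeilSeq Cₛ^∞⟮I; FA, A⟯ (VField I M) Cₛ^∞⟮I; FV, V⟯ (p + 1) q
  | 0, _, _, _, _, _, _, _ => 0
  | a + 1, k, m, ha, hm, α, β, X =>
      altSum (fun α₀ α' => lieDer R α₀ (c a k m (by omega) hm α') β X) α +
        bracketSum (fun α₁ α₂ => L.bracket α₁ α₂) (fun α' => c a k m (by omega) hm α' β X) α

/-- The sum `∑ⱼ ι_{ρ(βⱼ)} c_{k-1}(α ‖ β₁, …, β̂ⱼ, …, βₖ)`. -/
def deltaContract (L : LieAlgebroid I FA A) {p q : ℕ}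
    (c : WeilSeq Cₛ^∞⟮I; FA, A⟯ (VField I M) Cₛ^∞⟮I; FV, V⟯ p q) :
    WeilSeq Cₛ^∞⟮I; FA, A⟯ (VField I M) Cₛ^∞⟮I; FV, V⟯ (p + 1) q
  | _, 0, _, _, _, _, _, _ => 0
  | a, k + 1, m, ha, hm, α, β, X => ∑ j : Fin (k + 1),
      c a k (m + 1) (by omega) (by omega) α (j.removeNth β) (Fin.cons (L.rho (β j)) X)

/-- The simplicial differential `δ : W^{p,q}(A; V) → W^{p+1,q}(A; V)`. -/
def weilDelta {p q : ℕ} (c : WeilSeq Cₛ^∞⟮I; FA, A⟯ (VField I M) Cₛ^∞⟮I; FV, V⟯ p q) :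
    WeilSeq Cₛ^∞⟮I; FA, A⟯ (VField I M) Cₛ^∞⟮I; FV, V⟯ (p + 1) q :=
  fun a k m ha hm α β X => (-1 : ℤ) ^ k •
    (deltaKoszul R c a k m ha hm α β X - deltaContract L c a k m ha hm α β X)

end Simplicial

/-! The wedge product with an `End V`-valued cochain of bidegree `(1, 1)`. -/

section Wedge

/-- The sequence `(T, θ)` of bidegree `(1, 1)`, with leading term `T` and correction term `θ`. -/
def pairSeq {S T N : Type*} [Zero N] (lead : S → T → N) (corr : S → N) : WeilSeq S T N 1 1
  | 1, 0, 1, _, _, α, _, X => lead (α 0) (X 0)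
  | 0, 1, 0, _, _, _, β, _ => corr (β 0)
  | _, _, _, _, _, _, _, _ => 0

/-- The sum `∑ᵢ (-1)ⁱ T(αᵢ) ∧ c_k(α₀, …, α̂ᵢ, …, α_{p-k} ‖ β)`. -/
def wedgeLead (T : Cₛ^∞⟮I; FA, A⟯ → VField I M → Module.End C^∞⟮I, M; ℝ⟯ Cₛ^∞⟮I; FV, V⟯)
    {p q : ℕ} (c : WeilSeq Cₛ^∞⟮I; FA, A⟯ (VField I M) Cₛ^∞⟮I; FV, V⟯ p q) :
    WeilSeq Cₛ^∞⟮I; FA, A⟯ (VField I M) Cₛ^∞⟮I; FV, V⟯ (p + 1) (q + 1)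
  | a + 1, k, m + 1, ha, hm, α, β, X =>
      altSum (fun α₀ α' =>
        altSum (fun Y X' => T α₀ Y (c a k m (by omega) (by omega) α' β X')) X) α
  | _, _, _, _, _, _, _, _ => 0

/-- The sum `∑ⱼ θ(βⱼ) · c_{k-1}(α ‖ β₁, …, β̂ⱼ, …, βₖ)`. -/
def wedgeCorr (θ : Cₛ^∞⟮I; FA, A⟯ → Module.End C^∞⟮I, M; ℝ⟯ Cₛ^∞⟮I; FV, V⟯)
    {p q : ℕ} (c : WeilSeq Cₛ^∞⟮I; FA, A⟯ (VField I M) Cₛ^∞⟮I; FV, V⟯ p q) :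
    WeilSeq Cₛ^∞⟮I; FA, A⟯ (VField I M) Cₛ^∞⟮I; FV, V⟯ (p + 1) (q + 1)
  | _, 0, _, _, _, _, _, _ => 0
  | a, k + 1, m, ha, hm, α, β, X => ∑ j : Fin (k + 1),
      θ (β j) (c a k m (by omega) (by omega) α (j.removeNth β) X)

/-- The wedge product `(T, θ) ∧ c`. -/
def weilWedge (T : Cₛ^∞⟮I; FA, A⟯ → VField I M → Module.End C^∞⟮I, M; ℝ⟯ Cₛ^∞⟮I; FV, V⟯)
    (θ : Cₛ^∞⟮I; FA, A⟯ → Module.End C^∞⟮I, M; ℝ⟯ Cₛ^∞⟮I; FV, V⟯)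
    {p q : ℕ} (c : WeilSeq Cₛ^∞⟮I; FA, A⟯ (VField I M) Cₛ^∞⟮I; FV, V⟯ p q) :
    WeilSeq Cₛ^∞⟮I; FA, A⟯ (VField I M) Cₛ^∞⟮I; FV, V⟯ (p + 1) (q + 1) :=
  fun a k m ha hm α β X => wedgeLead T c a k m ha hm α β X + wedgeCorr θ c a k m ha hm α β X

end Wedge

/-! The exterior covariant derivative and the `A`-invariance form. -/

section Covariant

variable [∀ x, IsTopologicalAddGroup (V x)] [∀ x, ContinuousSMul ℝ (V x)]
  (nab : CovariantDerivative I FV V) [nab.ContMDiffCovariantDerivative ∞]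

/-- The exterior covariant derivative `d^∇ : Ω^m(M; V) → Ω^{m+1}(M; V)`. -/
def extCov {m : ℕ} (η : (Fin m → VField I M) → Cₛ^∞⟮I; FV, V⟯) (X : Fin (m + 1) → VField I M) :
    Cₛ^∞⟮I; FV, V⟯ :=
  altSum (fun Y X' => covSec nab Y (η X')) X + bracketSum vbracket η X

/-- The term `d^∇ c_k(α ‖ β)`. -/
def covLead {p q : ℕ} (c : WeilSeq Cₛ^∞⟮I; FA, A⟯ (VField I M) Cₛ^∞⟮I; FV, V⟯ p q) :
    WeilSeq Cₛ^∞⟮I; FA, A⟯ (VField I M) Cₛ^∞⟮I; FV, V⟯ p (q + 1)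
  | _, _, 0, _, _, _, _, _ => 0
  | a, k, m + 1, ha, hm, α, β, X => extCov nab (c a k m ha (by omega) α β) X

/-- The sum `∑ᵢ c_{k-1}(βᵢ, α ‖ β₁, …, β̂ᵢ, …, βₖ)`. -/
def covCorr {p q : ℕ} (c : WeilSeq Cₛ^∞⟮I; FA, A⟯ (VField I M) Cₛ^∞⟮I; FV, V⟯ p q) :
    WeilSeq Cₛ^∞⟮I; FA, A⟯ (VField I M) Cₛ^∞⟮I; FV, V⟯ p (q + 1)
  | _, 0, _, _, _, _, _, _ => 0
  | a, k + 1, m, ha, hm, α, β, X => ∑ i : Fin (k + 1),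
      c (a + 1) k m (by omega) (by omega) (Fin.cons (β i) α) (i.removeNth β) X

/-- The exterior covariant derivative `d^∇ : W^{p,q}(A; V) → W^{p,q+1}(A; V)`. -/
def weilCov {p q : ℕ} (c : WeilSeq Cₛ^∞⟮I; FA, A⟯ (VField I M) Cₛ^∞⟮I; FV, V⟯ p q) :
    WeilSeq Cₛ^∞⟮I; FA, A⟯ (VField I M) Cₛ^∞⟮I; FV, V⟯ p (q + 1) :=
  fun a k m ha hm α β X => (-1 : ℤ) ^ k •
    (covLead nab c a k m ha hm α β X - covCorr c a k m ha hm α β X)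

variable {L : LieAlgebroid I FA A} (R : AlgebroidRep FV V L)

/-- The endomorphism `θ(α) = ∇^A_α - ∇_{ρ(α)}`. -/
def invTheta (α : Cₛ^∞⟮I; FA, A⟯) : Module.End C^∞⟮I, M; ℝ⟯ Cₛ^∞⟮I; FV, V⟯ where
  toFun s := R.act α s - covSec nab (L.rho α) s
  map_add' s t := by simp only [covSec_add, map_add]; abel
  map_smul' f s := by
    simp only [covSec_leibniz, R.leibniz, RingHom.id_apply]
    module

/-- The `End V`-valued one-form `T(α) = d^∇ θ(α) - ι_{ρ(α)} R^∇`, evaluated on a vector field. -/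
def invT (α : Cₛ^∞⟮I; FA, A⟯) (X : VField I M) : Module.End C^∞⟮I, M; ℝ⟯ Cₛ^∞⟮I; FV, V⟯ :=
  endCov nab X (invTheta nab R α) - curvature nab (L.rho α) X

/-- The connection is `A`-invariant: `∇^A_α = ∇_{ρ(α)}` and `ι_{ρ(α)} R^∇ = 0` for all `α`. -/
def IsInvariantConnection : Prop :=
  ∀ α : Cₛ^∞⟮I; FA, A⟯, (∀ s : Cₛ^∞⟮I; FV, V⟯, R.act α s = covSec nab (L.rho α) s) ∧
    ∀ X : VField I M, curvature nab (L.rho α) X = 0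

end Covariant

end Weil

end LieAlgebroidWeil

end

open LieAlgebroidWeil

noncomputable section

namespace LieAlgebroidWeil

/-! ### Operators on functions of lists -/

section ListOperators

variable {S P Q : Type*} [AddCommGroup P] [AddCommGroup Q]

/-- The alternating sum `∑ᵢ (-1)ⁱ F(xᵢ; x₀, …, x̂ᵢ, …)` over the entries of a list. -/
def altL : (S → List S → P) → List S → P
  | _, [] => 0
  | F, y :: l => F y l - altL (fun z l' => F z (y :: l')) l

/-- The sum `∑ᵢ F(xᵢ; x₀, …, x̂ᵢ, …)` over the entries of a list. -/
def symL : (S → List S → P) → List S → P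
  | _, [] => 0
  | F, y :: l => F y l + symL (fun z l' => F z (y :: l')) l

/-- The sum `∑ᵢ w(x₀, …, g(xᵢ), …)` over the entries of a list. -/
def rep (g : S → S) : (List S → P) → List S → P
  | _, [] => 0
  | w, y :: l => w (g y :: l) + rep g (fun l' => w (y :: l')) l

theorem map_altL {Φ : Type*} [FunLike Φ P Q] [AddMonoidHomClass Φ P Q] (φ : Φ) (F : S → List S → P) (l : List S) :
    φ (altL F l) = altL (fun y l' => φ (F y l')) l := by
  induction l generalizing F with
  | nil => simp [altL]
  | cons y l ih => simp only [altL, map_sub, ih]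

theorem map_symL {Φ : Type*} [FunLike Φ P Q] [AddMonoidHomClass Φ P Q] (φ : Φ) (F : S → List S → P) (l : List S) :
    φ (symL F l) = symL (fun y l' => φ (F y l')) l := by
  induction l generalizing F with
  | nil => simp [symL]
  | cons y l ih => simp only [symL, map_add, ih]

theorem map_rep {Φ : Type*} [FunLike Φ P Q] [AddMonoidHomClass Φ P Q] (φ : Φ) (g : S → S) (w : List S → P) (l : List S) :
    φ (rep g w l) = rep g (fun l' => φ (w l')) l := by
  induction l generalizing w with
  | nil => simp [rep]
  | cons y l ih => simp only [rep, map_add, ih]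

theorem altL_add (F G : S → List S → P) (l : List S) :
    altL (fun y l' => F y l' + G y l') l = altL F l + altL G l := by
  induction l generalizing F G with
  | nil => simp [altL]
  | cons y l ih => simp only [altL, ih]; abel

theorem symL_add (F G : S → List S → P) (l : List S) :
    symL (fun y l' => F y l' + G y l') l = symL F l + symL G l := by
  induction l generalizing F G with
  | nil => simp [symL]
  | cons y l ih => simp only [symL, ih]; abel

theorem rep_add (g : S → S) (w η : List S → P) (l : List S) :
    rep g (fun l' => w l' + η l') l = rep g w l + rep g η l := by
  induction l generalizing w η with
  | nil => simp [rep]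
  | cons y l ih => simp only [rep, ih]; abel

theorem altL_neg (F : S → List S → P) (l : List S) :
    altL (fun y l' => -F y l') l = -altL F l :=
  (map_altL (-AddMonoidHom.id P) F l).symm

theorem symL_neg (F : S → List S → P) (l : List S) :
    symL (fun y l' => -F y l') l = -symL F l :=
  (map_symL (-AddMonoidHom.id P) F l).symm

theorem rep_neg (g : S → S) (w : List S → P) (l : List S) :
    rep g (fun l' => -w l') l = -rep g w l :=
  (map_rep (-AddMonoidHom.id P) g w l).symm

theorem altL_sub (F G : S → List S → P) (l : List S) :
    altL (fun y l' => F y l' - G y l') l = altL F l - altL G l := by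
  simp only [sub_eq_add_neg, altL_add, altL_neg]

theorem symL_sub (F G : S → List S → P) (l : List S) :
    symL (fun y l' => F y l' - G y l') l = symL F l - symL G l := by
  simp only [sub_eq_add_neg, symL_add, symL_neg]

theorem rep_sub (g : S → S) (w η : List S → P) (l : List S) :
    rep g (fun l' => w l' - η l') l = rep g w l - rep g η l := by
  simp only [sub_eq_add_neg, rep_add, rep_neg]

theorem altL_zero (l : List S) : altL (fun _ _ => (0 : P)) l = 0 :=
  (map_altL (0 : P →+ P) (fun _ _ => 0) l).symm

theorem symL_zero (l : List S) : symL (fun _ _ => (0 : P)) l = 0 :=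
  (map_symL (0 : P →+ P) (fun _ _ => 0) l).symm

theorem rep_zero (g : S → S) (l : List S) : rep g (fun _ => (0 : P)) l = 0 :=
  (map_rep (0 : P →+ P) g (fun _ => 0) l).symm

section smul

variable {R : Type*} [Monoid R] [DistribMulAction R P]

theorem altL_smul (c : R) (F : S → List S → P) (l : List S) :
    altL (fun y l' => c • F y l') l = c • altL F l :=
  (map_altL (DistribSMul.toAddMonoidHom P c) F l).symm

theorem symL_smul (c : R) (F : S → List S → P) (l : List S) :
    symL (fun y l' => c • F y l') l = c • symL F l :=
  (map_symL (DistribSMul.toAddMonoidHom P c) F l).symm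

theorem rep_smul (c : R) (g : S → S) (w : List S → P) (l : List S) :
    rep g (fun l' => c • w l') l = c • rep g w l :=
  (map_rep (DistribSMul.toAddMonoidHom P c) g w l).symm

end smul

theorem altL_apply {X : Type*} (F : S → List S → X → P) (l : List S) (x : X) :
    altL F l x = altL (fun y l' => F y l' x) l :=
  map_altL (Pi.evalAddMonoidHom (fun _ => P) x) F l

theorem symL_apply {X : Type*} (F : S → List S → X → P) (l : List S) (x : X) :
    symL F l x = symL (fun y l' => F y l' x) l :=
  map_symL (Pi.evalAddMonoidHom (fun _ => P) x) F l

theorem rep_apply {X : Type*} (g : S → S) (w : List S → X → P) (l : List S) (x : X) :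
    rep g w l x = rep g (fun l' => w l' x) l :=
  map_rep (Pi.evalAddMonoidHom (fun _ => P) x) g w l

theorem altL_congr {F G : S → List S → P} {l : List S}
    (h : ∀ y l', l'.length + 1 = l.length → F y l' = G y l') : altL F l = altL G l := by
  induction l generalizing F G with
  | nil => rfl
  | cons y l ih =>
    simp only [altL]
    rw [h y l rfl, ih fun z l' hl => h z (y :: l') (by simp [hl])]

theorem symL_congr {F G : S → List S → P} {l : List S}
    (h : ∀ y l', l'.length + 1 = l.length → F y l' = G y l') : symL F l = symL G l := by
  induction l generalizing F G with
  | nil => rfl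
  | cons y l ih =>
    simp only [symL]
    rw [h y l rfl, ih fun z l' hl => h z (y :: l') (by simp [hl])]

theorem symL_sign (F : S → List S → P) (l : List S) :
    symL (fun y l' => (-1 : ℤ) ^ l'.length • F y l') l = -((-1 : ℤ) ^ l.length • symL F l) := by
  rw [← neg_smul, ← symL_smul]
  refine symL_congr fun y l' h => ?_
  rw [← h, pow_succ, mul_neg_one, neg_neg]

theorem rep_sign (g : S → S) (w : List S → P) (l : List S) :
    rep g (fun l' => (-1 : ℤ) ^ l'.length • w l') l = (-1 : ℤ) ^ l.length • rep g w l := by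
  induction l generalizing w with
  | nil => simp [rep]
  | cons y l ih =>
    have := ih fun l' => -w (y :: l')
    simp only [rep, List.length_cons, pow_succ, mul_neg_one, neg_smul, ← smul_neg] at this ⊢
    rw [this, rep_neg, neg_add, smul_add]

theorem rep_altL (g : S → S) (F : S → List S → P) (l : List S) :
    rep g (altL F) l = altL (fun y l' => F (g y) l' + rep g (F y) l') l := by
  induction l generalizing F with
  | nil => rfl
  | cons y l ih =>
    simp only [rep, altL, rep_sub, ih, altL_add]
    abel

theorem rep_symL (g : S → S) (F : S → List S → P) (l : List S) :
    rep g (symL F) l = symL (fun y l' => F (g y) l' + rep g (F y) l') l := by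
  induction l generalizing F with
  | nil => rfl
  | cons y l ih =>
    simp only [rep, symL, rep_add, ih, symL_add]
    abel

theorem symL_comm (G : S → S → List S → P) (l : List S) :
    symL (fun y l' => symL (fun z l'' => G y z l'') l') l =
      symL (fun y l' => symL (fun z l'' => G z y l'') l') l := by
  induction l generalizing G with
  | nil => rfl
  | cons y l ih =>
    simp only [symL, symL_add]
    rw [ih fun u v l' => G u v (y :: l')]
    abel

theorem altL_comm (G : S → S → List S → P) (l : List S) :
    altL (fun y l' => altL (fun z l'' => G y z l'') l') l =
      -altL (fun y l' => altL (fun z l'' => G z y l'') l') l := by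
  induction l generalizing G with
  | nil => simp [altL]
  | cons y l ih =>
    simp only [altL, altL_sub]
    rw [ih fun u v l' => G u v (y :: l')]
    abel

theorem altL_symL_comm {U : Type*} (G : S → List S → U → List U → P) (l : List S) (u : List U) :
    altL (fun y l' => symL (fun z u' => G y l' z u') u) l =
      symL (fun z u' => altL (fun y l' => G y l' z u') l) u := by
  induction l generalizing G with
  | nil => simp [altL, symL_zero]
  | cons y l ih => simp only [altL, ih, symL_sub]

theorem altL_altL_comm {U : Type*} (G : S → List S → U → List U → P) (l : List S) (u : List U) :
    altL (fun y l' => altL (fun z u' => G y l' z u') u) l =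
      altL (fun z u' => altL (fun y l' => G y l' z u') l) u := by
  induction l generalizing G with
  | nil => simp [altL, altL_zero]
  | cons y l ih => simp only [altL, ih, altL_sub]

theorem rep_altL_comm {U : Type*} (g : S → S) (γ : List S → U → List U → P)
    (l : List S) (u : List U) :
    rep g (fun l' => altL (fun z u' => γ l' z u') u) l =
      altL (fun z u' => rep g (fun l' => γ l' z u') l) u := by
  induction l generalizing γ with
  | nil => simp [rep, altL_zero]
  | cons y l ih => simp only [rep, ih, altL_add]

theorem rep_symL_comm {U : Type*} (g : S → S) (γ : List S → U → List U → P)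
    (l : List S) (u : List U) :
    rep g (fun l' => symL (fun z u' => γ l' z u') u) l =
      symL (fun z u' => rep g (fun l' => γ l' z u') l) u := by
  induction l generalizing γ with
  | nil => simp [rep, symL_zero]
  | cons y l ih => simp only [rep, ih, symL_add]

theorem altL_mem (A : AddSubgroup P) {F : S → List S → P} (h : ∀ y l, F y l ∈ A) (l : List S) :
    altL F l ∈ A := by
  induction l generalizing F with
  | nil => exact A.zero_mem
  | cons y l ih => exact A.sub_mem (h _ _) (ih fun _ _ => h _ _)

theorem symL_mem (A : AddSubgroup P) {F : S → List S → P} (h : ∀ y l, F y l ∈ A) (l : List S) :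
    symL F l ∈ A := by
  induction l generalizing F with
  | nil => exact A.zero_mem
  | cons y l ih => exact A.add_mem (h _ _) (ih fun _ _ => h _ _)

theorem rep_mem (A : AddSubgroup P) {g : S → S} {w : List S → P} (h : ∀ l, w l ∈ A)
    (l : List S) : rep g w l ∈ A := by
  induction l generalizing w with
  | nil => exact A.zero_mem
  | cons y l ih => exact A.add_mem (h _) (ih fun _ => h _)

/-- The Koszul-type differential of functions of lists, given by the Cartan formula
`ι_y (d w) = 𝓛_y w - d (ι_y w)`, where `𝓛_y` acts by `D y` on values and by `br y` on arguments. -/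
def kos {K : Type*} [Semiring K] [Module K P] (D : S → Module.End K P) (br : S → S → S) :
    (List S → P) → List S → P
  | _, [] => 0
  | w, y :: l => D y (w l) - rep (br y) w l - kos D br (fun l' => w (y :: l')) l

section kos

variable {K : Type*} [CommRing K] [Module K P] (D : S → Module.End K P) (br : S → S → S)

theorem kos_add (w η : List S → P) (l : List S) :
    kos D br (fun l' => w l' + η l') l = kos D br w l + kos D br η l := by
  induction l generalizing w η with
  | nil => simp [kos]
  | cons y l ih => simp only [kos, ih, rep_add, map_add]; abel

theorem kos_smul (c : K) (w : List S → P) (l : List S) :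
    kos D br (fun l' => c • w l') l = c • kos D br w l := by
  induction l generalizing w with
  | nil => simp [kos]
  | cons y l ih => simp only [kos, ih, rep_smul, map_smul, smul_sub]

/-- The Koszul-type differential as a linear map. -/
def kosHom : (List S → P) →ₗ[K] List S → P where
  toFun := kos D br
  map_add' w η := funext fun l => kos_add D br w η l
  map_smul' c w := funext fun l => kos_smul D br c w l

theorem kos_neg (w : List S → P) (l : List S) :
    kos D br (fun l' => -w l') l = -kos D br w l :=
  congrFun (map_neg (kosHom D br) w) l

theorem kos_sub (w η : List S → P) (l : List S) :
    kos D br (fun l' => w l' - η l') l = kos D br w l - kos D br η l :=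
  congrFun (map_sub (kosHom D br) w η) l

theorem kos_zero (l : List S) : kos D br (fun _ => 0) l = 0 :=
  congrFun (map_zero (kosHom D br)) l

theorem kos_symL {U : Type*} (F : U → List U → List S → P) (u : List U) (l : List S) :
    kos D br (fun l' => symL (fun z u' => F z u' l') u) l =
      symL (fun z u' => kos D br (F z u') l) u := by
  rw [← symL_apply (fun z u' => kos D br (F z u'))]
  have := map_symL (kosHom D br).toAddMonoidHom F u
  simp only [← symL_apply]
  exact congrFun this l

theorem kos_rep {U : Type*} (g : U → U) (F : List U → List S → P) (u : List U) (l : List S) :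
    kos D br (fun l' => rep g (fun u' => F u' l') u) l =
      rep g (fun u' => kos D br (F u') l) u := by
  rw [← rep_apply g (fun u' => kos D br (F u'))]
  have := map_rep (kosHom D br).toAddMonoidHom g F u
  simp only [← rep_apply]
  exact congrFun this l

theorem kos_mem (A : AddSubgroup P) (hD : ∀ y, ∀ p ∈ A, D y p ∈ A) {w : List S → P}
    (h : ∀ l, w l ∈ A) (l : List S) : kos D br w l ∈ A := by
  induction l generalizing w with
  | nil => exact A.zero_mem
  | cons y l ih =>
    exact A.sub_mem (A.sub_mem (hD _ _ (h _)) (rep_mem A h l)) (ih fun _ => h _)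

end kos

end ListOperators

/-! ### Alternating and symmetric multilinear functions of lists -/

section Multilinear

variable (R : Type*) [CommRing R] {S P Q : Type*} [AddCommGroup S] [Module R S]
  [AddCommGroup P] [Module R P] [AddCommGroup Q] [Module R Q]

/-- The function `w` of lists is linear in the entry number `n` and vanishes if this entry equals
the next one. -/
def AltAt : ℕ → (List S → P) → Prop
  | 0, w => (∀ y z r, w ((y + z) :: r) = w (y :: r) + w (z :: r)) ∧
      (∀ (c : R) y r, w ((c • y) :: r) = c • w (y :: r)) ∧ ∀ y r, w (y :: y :: r) = 0
  | n + 1, w => ∀ y, AltAt n fun l => w (y :: l)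

/-- The function `w` of lists is linear in the entry number `n` and does not change if this entry is
swapped with the next one. -/
def SymAt : ℕ → (List S → P) → Prop
  | 0, w => (∀ y z r, w ((y + z) :: r) = w (y :: r) + w (z :: r)) ∧
      (∀ (c : R) y r, w ((c • y) :: r) = c • w (y :: r)) ∧
      ∀ y z r, w (y :: z :: r) = w (z :: y :: r)
  | n + 1, w => ∀ y, SymAt n fun l => w (y :: l)

/-- The function `w` of lists is alternating and multilinear. -/
def IsAlt (w : List S → P) : Prop := ∀ n, AltAt R n w

/-- The function `w` of lists is symmetric and multilinear. -/
def IsSym (w : List S → P) : Prop := ∀ n, SymAt R n w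

variable {R}

theorem AltAt.sub {n : ℕ} {w η : List S → P} (h : AltAt R n w) (h' : AltAt R n η) :
    AltAt R n fun l => w l - η l := by
  induction n generalizing w η with
  | zero =>
    refine ⟨fun y z r => ?_, fun c y r => ?_, fun y r => ?_⟩
    · dsimp only; rw [h.1, h'.1]; abel
    · dsimp only; rw [h.2.1, h'.2.1, smul_sub]
    · dsimp only; rw [h.2.2, h'.2.2, sub_zero]
  | succ n ih => exact fun y => ih (h y) (h' y)

theorem SymAt.sub {n : ℕ} {w η : List S → P} (h : SymAt R n w) (h' : SymAt R n η) :
    SymAt R n fun l => w l - η l := by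
  induction n generalizing w η with
  | zero =>
    refine ⟨fun y z r => ?_, fun c y r => ?_, fun y z r => ?_⟩
    · dsimp only; rw [h.1, h'.1]; abel
    · dsimp only; rw [h.2.1, h'.2.1, smul_sub]
    · dsimp only; rw [h.2.2, h'.2.2]
  | succ n ih => exact fun y => ih (h y) (h' y)

theorem AltAt.map {n : ℕ} {w : List S → P} (h : AltAt R n w) (φ : P →ₗ[R] Q) :
    AltAt R n fun l => φ (w l) := by
  induction n generalizing w with
  | zero =>
    refine ⟨fun y z r => ?_, fun c y r => ?_, fun y r => ?_⟩
    · dsimp only; rw [h.1, map_add]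
    · dsimp only; rw [h.2.1, map_smul]
    · dsimp only; rw [h.2.2, map_zero]
  | succ n ih => exact fun y => ih (h y)

theorem SymAt.map {n : ℕ} {w : List S → P} (h : SymAt R n w) (φ : P →ₗ[R] Q) :
    SymAt R n fun l => φ (w l) := by
  induction n generalizing w with
  | zero =>
    refine ⟨fun y z r => ?_, fun c y r => ?_, fun y z r => ?_⟩
    · dsimp only; rw [h.1, map_add]
    · dsimp only; rw [h.2.1, map_smul]
    · dsimp only; rw [h.2.2]
  | succ n ih => exact fun y => ih (h y)

theorem IsAlt.map {w : List S → P} (h : IsAlt R w) (φ : P →ₗ[R] Q) :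
    IsAlt R fun l => φ (w l) := fun n => (h n).map φ

theorem IsSym.map {w : List S → P} (h : IsSym R w) (φ : P →ₗ[R] Q) :
    IsSym R fun l => φ (w l) := fun n => (h n).map φ

theorem IsAlt.sub {w η : List S → P} (h : IsAlt R w) (h' : IsAlt R η) :
    IsAlt R fun l => w l - η l := fun n => (h n).sub (h' n)

theorem IsSym.sub {w η : List S → P} (h : IsSym R w) (h' : IsSym R η) :
    IsSym R fun l => w l - η l := fun n => (h n).sub (h' n)

theorem IsAlt.zero : IsAlt R fun _ : List S => (0 : P) := by
  intro n
  induction n with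
  | zero => simp [AltAt]
  | succ n ih => exact fun _ => ih

theorem IsSym.zero : IsSym R fun _ : List S => (0 : P) := by
  intro n
  induction n with
  | zero => simp [SymAt]
  | succ n ih => exact fun _ => ih

theorem IsAlt.neg {w : List S → P} (h : IsAlt R w) : IsAlt R fun l => -w l := by
  simpa using IsAlt.zero.sub h

theorem IsSym.neg {w : List S → P} (h : IsSym R w) : IsSym R fun l => -w l := by
  simpa using IsSym.zero.sub h

theorem IsAlt.add {w η : List S → P} (h : IsAlt R w) (h' : IsAlt R η) :
    IsAlt R fun l => w l + η l := by
  simpa using h.sub h'.neg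

theorem IsSym.add {w η : List S → P} (h : IsSym R w) (h' : IsSym R η) :
    IsSym R fun l => w l + η l := by
  simpa using h.sub h'.neg

variable (R S P) in
/-- The group of alternating multilinear functions of lists. -/
def altGroup : AddSubgroup (List S → P) where
  carrier := {w | IsAlt R w}
  zero_mem' := IsAlt.zero
  add_mem' := IsAlt.add
  neg_mem' := IsAlt.neg

variable (R S P) in
/-- The group of symmetric multilinear functions of lists. -/
def symGroup : AddSubgroup (List S → P) where
  carrier := {w | IsSym R w}
  zero_mem' := IsSym.zero
  add_mem' := IsSym.add
  neg_mem' := IsSym.neg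

theorem AltAt.add {n : ℕ} {w η : List S → P} (h : AltAt R n w) (h' : AltAt R n η) :
    AltAt R n fun l => w l + η l := by
  simpa using h.sub ((IsAlt.zero n).sub h')

theorem SymAt.add {n : ℕ} {w η : List S → P} (h : SymAt R n w) (h' : SymAt R n η) :
    SymAt R n fun l => w l + η l := by
  simpa using h.sub ((IsSym.zero n).sub h')

theorem IsAlt.cons {w : List S → P} (h : IsAlt R w) (y : S) : IsAlt R fun l => w (y :: l) :=
  fun n => h (n + 1) y

theorem IsSym.cons {w : List S → P} (h : IsSym R w) (y : S) : IsSym R fun l => w (y :: l) :=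
  fun n => h (n + 1) y

theorem IsAlt.add_cons {w : List S → P} (h : IsAlt R w) (y z : S) (r : List S) :
    w ((y + z) :: r) = w (y :: r) + w (z :: r) := (h 0).1 y z r

theorem IsAlt.smul_cons {w : List S → P} (h : IsAlt R w) (c : R) (y : S) (r : List S) :
    w ((c • y) :: r) = c • w (y :: r) := (h 0).2.1 c y r

theorem IsAlt.self {w : List S → P} (h : IsAlt R w) (y : S) (r : List S) :
    w (y :: y :: r) = 0 := (h 0).2.2 y r

theorem IsAlt.neg_cons {w : List S → P} (h : IsAlt R w) (y : S) (r : List S) :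
    w ((-y) :: r) = -w (y :: r) := by
  simpa using h.smul_cons (-1) y r

theorem IsAlt.swap {w : List S → P} (h : IsAlt R w) (y z : S) (r : List S) :
    w (y :: z :: r) = -w (z :: y :: r) := by
  have h1 := h.self (y + z) r
  rw [h.add_cons, (h.cons y).add_cons, (h.cons z).add_cons, h.self, h.self] at h1
  rw [eq_neg_iff_add_eq_zero]
  simpa using h1

theorem IsSym.add_cons {w : List S → P} (h : IsSym R w) (y z : S) (r : List S) :
    w ((y + z) :: r) = w (y :: r) + w (z :: r) := (h 0).1 y z r

theorem IsSym.smul_cons {w : List S → P} (h : IsSym R w) (c : R) (y : S) (r : List S) :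
    w ((c • y) :: r) = c • w (y :: r) := (h 0).2.1 c y r

theorem IsSym.neg_cons {w : List S → P} (h : IsSym R w) (y : S) (r : List S) :
    w ((-y) :: r) = -w (y :: r) := by
  simpa using h.smul_cons (-1) y r

theorem IsSym.swap {w : List S → P} (h : IsSym R w) (y z : S) (r : List S) :
    w (y :: z :: r) = w (z :: y :: r) := (h 0).2.2 y z r

theorem isAlt_pi {X : Type*} {w : List S → X → P} :
    IsAlt R w ↔ ∀ x, IsAlt R fun l => w l x := by
  refine ⟨fun h x => h.map (LinearMap.proj x), fun h n => ?_⟩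
  replace h := fun x => h x n
  induction n generalizing w with
  | zero =>
    exact ⟨fun y z r => funext fun x => (h x).1 y z r,
      fun c y r => funext fun x => (h x).2.1 c y r, fun y r => funext fun x => (h x).2.2 y r⟩
  | succ n ih => exact fun y => ih fun x => h x y

theorem isSym_pi {X : Type*} {w : List S → X → P} :
    IsSym R w ↔ ∀ x, IsSym R fun l => w l x := by
  refine ⟨fun h x => h.map (LinearMap.proj x), fun h n => ?_⟩
  replace h := fun x => h x n
  induction n generalizing w with
  | zero =>
    exact ⟨fun y z r => funext fun x => (h x).1 y z r,
      fun c y r => funext fun x => (h x).2.1 c y r, fun y z r => funext fun x => (h x).2.2 y z r⟩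
  | succ n ih => exact fun y => ih fun x => h x y

section upgrade

variable {K : Type*} [CommRing K] [Module K S] [Module K P]

theorem IsAlt.of_smul_cons {w : List S → P} (h : IsAlt K w)
    (hs : ∀ (c : R) y r, w ((c • y) :: r) = c • w (y :: r)) : IsAlt R w := by
  intro n
  induction n generalizing w with
  | zero => exact ⟨h.add_cons, hs, h.self⟩
  | succ n ih =>
    refine fun y => ih (h.cons y) fun c z r => ?_
    rw [h.swap y (c • z), hs, h.swap y z, smul_neg]

theorem IsSym.of_smul_cons {w : List S → P} (h : IsSym K w)
    (hs : ∀ (c : R) y r, w ((c • y) :: r) = c • w (y :: r)) : IsSym R w := by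
  intro n
  induction n generalizing w with
  | zero => exact ⟨h.add_cons, hs, h.swap⟩
  | succ n ih =>
    refine fun y => ih (h.cons y) fun c z r => ?_
    rw [h.swap y (c • z), hs, h.swap y z]

theorem IsAlt.restrict {A : Type*} [CommRing A] [Algebra K A] [Module A S] [Module A P]
    [IsScalarTower K A S] [IsScalarTower K A P] {w : List S → P} (h : IsAlt A w) :
    IsAlt K w := h.of_smul_cons fun c y r => by
  rw [← algebraMap_smul A c y, h.smul_cons, algebraMap_smul]

theorem IsSym.restrict {A : Type*} [CommRing A] [Algebra K A] [Module A S] [Module A P]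
    [IsScalarTower K A S] [IsScalarTower K A P] {w : List S → P} (h : IsSym A w) :
    IsSym K w := h.of_smul_cons fun c y r => by
  rw [← algebraMap_smul A c y, h.smul_cons, algebraMap_smul]

end upgrade

theorem IsSym.sign {w : List S → P} (h : IsSym R w) :
    IsSym R fun l => (-1 : ℤ) ^ l.length • w l := by
  have aux : ∀ (n : ℕ) (k : ℤ) (w : List S → P), IsSym R w →
      SymAt R n fun l => (k * (-1 : ℤ) ^ l.length) • w l := by
    intro n
    induction n with
    | zero =>
      refine fun k w h => ⟨fun y z r => ?_, fun c y r => ?_, fun y z r => ?_⟩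
      · simp only [List.length_cons, h.add_cons, smul_add]
      · simp only [List.length_cons, h.smul_cons]
        rw [smul_comm]
      · simp only [List.length_cons, h.swap y z]
    | succ n ih =>
      intro k w h y
      have := ih (k * (-1)) _ (h.cons y)
      simpa only [List.length_cons, pow_succ', mul_assoc] using this
  intro n
  simpa using aux n 1 w h

theorem altL_isAlt {F : S → List S → P} (hadd : ∀ y z l, F (y + z) l = F y l + F z l)
    (hsmul : ∀ (c : R) y l, F (c • y) l = c • F y l) (h : ∀ y, IsAlt R (F y)) :
    IsAlt R (altL F) := by
  intro n
  induction n generalizing F with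
  | zero =>
    refine ⟨fun y z r => ?_, fun c y r => ?_, fun y r => ?_⟩
    · simp only [altL, (h _).add_cons, hadd, altL_add]; abel
    · simp only [altL, (h _).smul_cons, hsmul, altL_smul, smul_sub]
    · simp only [altL, (h _).self, altL_zero]; abel
  | succ n ih =>
    exact fun y => (h y n).sub
      (ih (fun _ _ _ => hadd _ _ _) (fun _ _ _ => hsmul _ _ _) fun z => (h z).cons y)

theorem symL_isSym {F : S → List S → P} (hadd : ∀ y z l, F (y + z) l = F y l + F z l)
    (hsmul : ∀ (c : R) y l, F (c • y) l = c • F y l) (h : ∀ y, IsSym R (F y)) :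
    IsSym R (symL F) := by
  intro n
  induction n generalizing F with
  | zero =>
    refine ⟨fun y z r => ?_, fun c y r => ?_, fun y z r => ?_⟩
    · simp only [symL, (h _).add_cons, hadd, symL_add]; abel
    · simp only [symL, (h _).smul_cons, hsmul, symL_smul, smul_add]
    · simp only [symL, (h _).swap y z]; abel
  | succ n ih =>
    intro y
    exact (h y n).add
      (ih (fun _ _ _ => hadd _ _ _) (fun _ _ _ => hsmul _ _ _) fun z => (h z).cons y)

/-! Replacing the entries of a list. -/

theorem rep_isAlt (g : S →ₗ[R] S) {w : List S → P} (h : IsAlt R w) : IsAlt R (rep g w) := by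
  intro n
  induction n generalizing w with
  | zero =>
    refine ⟨fun y z r => ?_, fun c y r => ?_, fun y r => ?_⟩
    · simp only [rep, h.add_cons, map_add, rep_add]; abel
    · simp only [rep, h.smul_cons, map_smul, rep_smul, smul_add]
    · simp only [rep, h.self, rep_zero, h.swap y (g y)]; abel
  | succ n ih =>
    intro y
    exact (h.cons (g y) n).add (ih (h.cons y))

theorem rep_isSym (g : S →ₗ[R] S) {w : List S → P} (h : IsSym R w) : IsSym R (rep g w) := by
  intro n
  induction n generalizing w with
  | zero =>
    refine ⟨fun y z r => ?_, fun c y r => ?_, fun y z r => ?_⟩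
    · simp only [rep, h.add_cons, map_add, rep_add]; abel
    · simp only [rep, h.smul_cons, map_smul, rep_smul, smul_add]
    · simp only [rep, h.swap y, h.swap (g y)]; abel
  | succ n ih =>
    intro y
    exact (h.cons (g y) n).add (ih (h.cons y))

theorem IsAlt.rep_eq {w : List S → P} (h : IsAlt R w) (g : S → S) (l : List S) :
    rep g w l = altL (fun z l' => w (g z :: l')) l := by
  induction l generalizing w with
  | nil => rfl
  | cons y l ih =>
    simp only [rep, altL, ih (h.cons y), h.swap y (g _), altL_neg]
    abel

theorem IsSym.rep_eq {w : List S → P} (h : IsSym R w) (g : S → S) (l : List S) :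
    rep g w l = symL (fun z l' => w (g z :: l')) l := by
  induction l generalizing w with
  | nil => rfl
  | cons y l ih => simp only [rep, symL, ih (h.cons y), h.swap y (g _)]

theorem IsAlt.rep_add_fun {w : List S → P} (h : IsAlt R w) (g g' : S → S) (l : List S) :
    rep (fun y => g y + g' y) w l = rep g w l + rep g' w l := by
  simp only [h.rep_eq, h.add_cons, altL_add]

theorem IsSym.rep_add_fun {w : List S → P} (h : IsSym R w) (g g' : S → S) (l : List S) :
    rep (fun y => g y + g' y) w l = rep g w l + rep g' w l := by
  simp only [h.rep_eq, h.add_cons, symL_add]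

theorem IsAlt.rep_neg_fun {w : List S → P} (h : IsAlt R w) (g : S → S) (l : List S) :
    rep (fun y => -g y) w l = -rep g w l := by
  simp only [h.rep_eq, h.neg_cons, altL_neg]

theorem IsSym.rep_neg_fun {w : List S → P} (h : IsSym R w) (g : S → S) (l : List S) :
    rep (fun y => -g y) w l = -rep g w l := by
  simp only [h.rep_eq, h.neg_cons, symL_neg]

theorem IsAlt.rep_sub_fun {w : List S → P} (h : IsAlt R w) (g g' : S → S) (l : List S) :
    rep (fun y => g y - g' y) w l = rep g w l - rep g' w l := by
  simp only [sub_eq_add_neg, h.rep_add_fun, h.rep_neg_fun]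

theorem IsSym.rep_sub_fun {w : List S → P} (h : IsSym R w) (g g' : S → S) (l : List S) :
    rep (fun y => g y - g' y) w l = rep g w l - rep g' w l := by
  simp only [sub_eq_add_neg, h.rep_add_fun, h.rep_neg_fun]

theorem IsAlt.rep_smul_fun {w : List S → P} (h : IsAlt R w) (c : R) (g : S → S) (l : List S) :
    rep (fun y => c • g y) w l = c • rep g w l := by
  simp only [h.rep_eq, h.smul_cons, altL_smul]

theorem IsSym.rep_smul_fun {w : List S → P} (h : IsSym R w) (c : R) (g : S → S) (l : List S) :
    rep (fun y => c • g y) w l = c • rep g w l := by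
  simp only [h.rep_eq, h.smul_cons, symL_smul]

theorem IsAlt.rep_commutator {w : List S → P} (h : IsAlt R w) (g g' : S → S) (l : List S) :
    rep g (rep g' w) l - rep g' (rep g w) l = rep (fun y => g' (g y) - g (g' y)) w l := by
  induction l generalizing w with
  | nil => simp [rep]
  | cons y l ih =>
    have h1 := h.add_cons (g' (g y)) (-g (g' y)) l
    rw [h.neg_cons, ← sub_eq_add_neg] at h1
    simp only [rep, rep_add, ← ih (h.cons y), h1]
    abel

theorem IsSym.symL_rep_eq_zero {γ : List S → P} (h : IsSym R γ) (br : S → S → S)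
    (hbr : ∀ y z, br y z = -br z y) (l : List S) :
    symL (fun z l' => rep (br z) γ l') l = 0 := by
  induction l generalizing γ with
  | nil => rfl
  | cons y l ih =>
    simp only [symL, rep, symL_add, ih (h.cons y), h.rep_eq, hbr y, h.neg_cons, symL_neg]
    abel

theorem kos_isAlt (D : S → Module.End R P) (br : S →ₗ[R] S →ₗ[R] S) (hbr : ∀ y, br y y = 0)
    {w : List S → P} (h : IsAlt R w) (hadd : ∀ y z l, D (y + z) (w l) = D y (w l) + D z (w l))
    (hsmul : ∀ (c : R) y l, D (c • y) (w l) = c • D y (w l)) :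
    IsAlt R (kos D (fun y => br y) w) := by
  intro n
  induction n generalizing w with
  | zero =>
    refine ⟨fun y z r => ?_, fun c y r => ?_, fun y r => ?_⟩
    · have h1 : rep (⇑(br y + br z)) w r = _ := h.rep_add_fun (br y) (br z) r
      simp only [kos, hadd, h.add_cons, kos_add, map_add, h1]
      abel
    · have h1 : rep (⇑(c • br y)) w r = _ := h.rep_smul_fun c (br y) r
      simp only [kos, hsmul, h.smul_cons, kos_smul, map_smul, h1, smul_sub]
    · simp only [kos, h.self, kos_zero, rep, hbr]
      have h0 : w (0 :: r) = 0 := by simpa using h.smul_cons 0 0 r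
      rw [h0]
      abel
  | succ n ih =>
    exact fun y => (((h.map (D y)).sub (rep_isAlt (br y) h)) n).sub
      (ih (h.cons y) (fun _ _ _ => hadd _ _ _) fun _ _ _ => hsmul _ _ _)

end Multilinear

/-! ### The calculus of a connection and a representation -/

/-- The algebraic data of a Lie algebroid, an `A`-connection and a connection on a vector bundle:
`C` stands for the smooth functions, `S` for the sections of the Lie algebroid, `T` for the vector
fields and `N` for the sections of the vector bundle. -/
structure Calculus (K C S T N : Type*) [CommRing K] [CommRing C] [Algebra K C]
    [AddCommGroup S] [Module K S] [Module C S] [AddCommGroup T] [Module K T] [Module C T]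
    [AddCommGroup N] [Module K N] [Module C N] [IsScalarTower K C N] where
  der : T →ₗ[C] C → C
  vbr : T →ₗ[K] T →ₗ[K] T
  br : S →ₗ[K] S →ₗ[K] S
  rho : S →ₗ[C] T
  nab : T →ₗ[C] Module.End K N
  act : S →ₗ[C] Module.End K N
  der_vbr : ∀ x y f, der (vbr x y) f = der x (der y f) - der y (der x f)
  vbr_self : ∀ x, vbr x x = 0
  vbr_smul : ∀ x y (f : C), vbr x (f • y) = f • vbr x y + der x f • y
  vbr_jacobi : ∀ x y z, vbr x (vbr y z) = vbr (vbr x y) z + vbr y (vbr x z)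
  br_self : ∀ a, br a a = 0
  br_smul : ∀ a b (f : C), br a (f • b) = f • br a b + der (rho a) f • b
  nab_smul : ∀ x (f : C) s, nab x (f • s) = f • nab x s + der x f • s
  act_smul : ∀ a (f : C) s, act a (f • s) = f • act a s + der (rho a) f • s

namespace Calculus

set_option linter.unusedSectionVars false

variable {K C S T N : Type*} [CommRing K] [CommRing C] [Algebra K C]
    [AddCommGroup S] [Module K S] [Module C S] [AddCommGroup T] [Module K T] [Module C T]
    [AddCommGroup N] [Module K N] [Module C N]
    [IsScalarTower K C S] [IsScalarTower K C T] [IsScalarTower K C N]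
    (G : Calculus K C S T N)

theorem vbr_skew (x y : T) : G.vbr x y = -G.vbr y x := by
  have h := G.vbr_self (x + y)
  simp only [map_add, LinearMap.add_apply, vbr_self, zero_add, add_zero] at h
  rw [add_comm] at h
  exact eq_neg_of_add_eq_zero_left h

theorem br_skew (a b : S) : G.br a b = -G.br b a := by
  have h := G.br_self (a + b)
  simp only [map_add, LinearMap.add_apply, br_self, zero_add, add_zero] at h
  rw [add_comm] at h
  exact eq_neg_of_add_eq_zero_left h

theorem vbr_smul_left (x y : T) (f : C) : G.vbr (f • x) y = f • G.vbr x y - G.der y f • x := by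
  rw [vbr_skew, vbr_smul, G.vbr_skew x y]
  module

theorem br_smul_left (a b : S) (f : C) :
    G.br (f • a) b = f • G.br a b - G.der (G.rho b) f • a := by
  rw [br_skew, br_smul, G.br_skew a b]
  module

/-! Forms with values in `N`. -/

/-- The exterior product `df ∧ w`. -/
def dWedge (f : C) (w : List T → N) : List T → N := altL fun x l => G.der x f • w l

/-- The operator on forms that acts by `φ` on values and by the bracket with `y` on arguments. -/
def lieT (φ : Module.End K N) (y : T) (w : List T → N) (l : List T) : N :=
  φ (w l) - rep (G.vbr y) w l

/-- The exterior covariant derivative. -/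
def dCov (w : List T → N) : List T → N := kos G.nab (fun x => G.vbr x) w

theorem dCov_cons (w : List T → N) (y : T) (l : List T) :
    G.dCov w (y :: l) = G.lieT (G.nab y) y w l - G.dCov (fun l' => w (y :: l')) l := rfl

theorem dCov_add (w η : List T → N) (l : List T) :
    G.dCov (fun l' => w l' + η l') l = G.dCov w l + G.dCov η l := kos_add ..

theorem dCov_sub (w η : List T → N) (l : List T) :
    G.dCov (fun l' => w l' - η l') l = G.dCov w l - G.dCov η l := kos_sub ..

theorem dWedge_cons (f : C) (w : List T → N) (y : T) (l : List T) :
    G.dWedge f w (y :: l) = G.der y f • w l - G.dWedge f (fun l' => w (y :: l')) l := rfl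

theorem dWedge_add (f : C) (w η : List T → N) (l : List T) :
    G.dWedge f (fun l' => w l' + η l') l = G.dWedge f w l + G.dWedge f η l := by
  simp only [dWedge, smul_add, altL_add]

theorem dWedge_sub (f : C) (w η : List T → N) (l : List T) :
    G.dWedge f (fun l' => w l' - η l') l = G.dWedge f w l - G.dWedge f η l := by
  simp only [dWedge, smul_sub, altL_sub]

theorem dWedge_neg (f : C) (w : List T → N) (l : List T) :
    G.dWedge f (fun l' => -w l') l = -G.dWedge f w l := by
  simp only [dWedge, smul_neg, altL_neg]

theorem dWedge_zsmul (f : C) (n : ℤ) (w : List T → N) (l : List T) :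
    G.dWedge f (fun l' => n • w l') l = n • G.dWedge f w l := by
  simp only [dWedge, smul_comm _ n, altL_smul]

theorem dWedge_symL {U : Type*} (f : C) (F : U → List U → List T → N) (u : List U) (l : List T) :
    G.dWedge f (fun l' => symL (fun z u' => F z u' l') u) l =
      symL (fun z u' => G.dWedge f (F z u') l) u := by
  simp only [dWedge, ← altL_symL_comm, symL_smul]

theorem dWedge_altL {U : Type*} (f : C) (F : U → List U → List T → N) (u : List U) (l : List T) :
    G.dWedge f (fun l' => altL (fun z u' => F z u' l') u) l =
      altL (fun z u' => G.dWedge f (F z u') l) u := by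
  simp only [dWedge, ← altL_altL_comm, altL_smul]

theorem dWedge_rep {U : Type*} (f : C) (g : U → U) (F : List U → List T → N) (u : List U)
    (l : List T) :
    G.dWedge f (fun l' => rep g (fun u' => F u' l') u) l =
      rep g (fun u' => G.dWedge f (F u') l) u := by
  simp only [dWedge, rep_altL_comm, rep_smul]

theorem dCov_smul (f : C) (w : List T → N) (l : List T) :
    G.dCov (fun l' => f • w l') l = f • G.dCov w l + G.dWedge f w l := by
  induction l generalizing w with
  | nil => simp [dCov, kos, dWedge, altL]
  | cons y l ih =>
    simp only [dCov_cons, lieT, dWedge_cons, ih, nab_smul, rep_smul]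
    module

theorem lieT_dWedge {φ : Module.End K N} {y : T}
    (hφ : ∀ (g : C) s, φ (g • s) = g • φ s + G.der y g • s) (f : C) (w : List T → N)
    (l : List T) :
    G.lieT φ y (G.dWedge f w) l = G.dWedge (G.der y f) w l + G.dWedge f (G.lieT φ y w) l := by
  simp only [lieT, dWedge, rep_altL, map_altL, hφ, rep_smul, der_vbr, ← altL_add, ← altL_sub]
  congr 1
  ext x l'
  module

theorem dCov_dWedge (f : C) (w : List T → N) (l : List T) :
    G.dCov (G.dWedge f w) l = -G.dWedge f (G.dCov w) l := by
  induction l generalizing w with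
  | nil => simp [dCov, kos, dWedge, altL]
  | cons y l ih =>
    rw [dCov_cons, G.lieT_dWedge (G.nab_smul y)]
    simp only [dWedge_cons, dCov_sub, ih, dCov_smul, dCov_cons, dWedge_sub]
    abel

theorem rep_vbr_smul {w : List T → N} (h : IsAlt C w) (f : C) (y : T) (l : List T) :
    rep (G.vbr (f • y)) w l = f • rep (G.vbr y) w l - G.dWedge f (fun l' => w (y :: l')) l := by
  have h1 : ⇑(G.vbr (f • y)) = fun z => f • G.vbr y z - G.der z f • y :=
    funext fun z => G.vbr_smul_left y z f
  rw [h1, h.rep_sub_fun, h.rep_smul_fun, h.rep_eq (fun z => G.der z f • y)]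
  simp only [h.smul_cons, dWedge]

theorem dCov_isAlt {w : List T → N} (h : IsAlt C w) : IsAlt C (G.dCov w) := by
  refine IsAlt.of_smul_cons (K := K) (kos_isAlt _ _ G.vbr_self h.restrict ?_ ?_) ?_
  · intro y z l
    rw [map_add, LinearMap.add_apply]
  · intro c y l
    rw [← algebraMap_smul C c y, map_smul, LinearMap.smul_apply, algebraMap_smul]
  · intro f y r
    simp only [dCov_cons, lieT, G.rep_vbr_smul h, h.smul_cons, dCov_smul, map_smul,
      LinearMap.smul_apply]
    module

theorem lieT_isAlt {φ : Module.End K N} {y : T}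
    (hφ : ∀ (g : C) s, φ (g • s) = g • φ s + G.der y g • s) {w : List T → N} (h : IsAlt C w) :
    IsAlt C (G.lieT φ y w) := by
  have hr : IsAlt K w := h.restrict
  refine ((hr.map φ).sub (rep_isAlt (G.vbr y) hr)).of_smul_cons fun f z r => ?_
  simp only [h.smul_cons, hφ, rep, rep_smul, vbr_smul, h.add_cons]
  module

/-! The invariance form. -/

/-- The difference `θ(a)` of the two connections. -/
def theta (a : S) : N →ₗ[C] N where
  toFun s := G.act a s - G.nab (G.rho a) s
  map_add' s t := by simp only [map_add]; abel
  map_smul' f s := by simp only [act_smul, nab_smul, RingHom.id_apply]; module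

/-- The one-form `T(a)`, evaluated on a vector field. -/
def tor (a : S) (x : T) : N →ₗ[C] N where
  toFun s := G.nab x (G.act a s) - G.act a (G.nab x s) + G.nab (G.vbr (G.rho a) x) s
  map_add' s t := by simp only [map_add]; abel
  map_smul' f s := by
    simp only [act_smul, nab_smul, map_add, RingHom.id_apply, der_vbr]
    module

theorem theta_apply (a : S) (s : N) : G.theta a s = G.act a s - G.nab (G.rho a) s := rfl

theorem tor_apply (a : S) (x : T) (s : N) : G.tor a x s =
    G.nab x (G.act a s) - G.act a (G.nab x s) + G.nab (G.vbr (G.rho a) x) s := rfl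

theorem theta_add (a b : S) (s : N) : G.theta (a + b) s = G.theta a s + G.theta b s := by
  simp only [theta_apply, map_add, LinearMap.add_apply]; abel

theorem theta_smul (f : C) (a : S) (s : N) : G.theta (f • a) s = f • G.theta a s := by
  simp only [theta_apply, map_smul, LinearMap.smul_apply]; module

theorem tor_add_left (a b : S) (x : T) (s : N) :
    G.tor (a + b) x s = G.tor a x s + G.tor b x s := by
  simp only [tor_apply, map_add, LinearMap.add_apply]; abel

theorem tor_smul_left (f : C) (a : S) (x : T) (s : N) :
    G.tor (f • a) x s = f • G.tor a x s + G.der x f • G.theta a s := by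
  simp only [tor_apply, theta_apply, map_smul, map_sub, LinearMap.smul_apply, LinearMap.sub_apply,
    nab_smul, vbr_smul_left]
  module

theorem tor_add_right (a : S) (x y : T) (s : N) :
    G.tor a (x + y) s = G.tor a x s + G.tor a y s := by
  simp only [tor_apply, map_add, LinearMap.add_apply]; abel

theorem tor_smul_right (f : C) (a : S) (x : T) (s : N) :
    G.tor a (f • x) s = f • G.tor a x s := by
  simp only [tor_apply, map_smul, map_add, LinearMap.smul_apply, LinearMap.add_apply,
    act_smul, vbr_smul]
  module

theorem dCov_lieT (a : S) {w : List T → N} (h : IsAlt C w) (l : List T) :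
    G.dCov (G.lieT (G.act a) (G.rho a) w) l - G.lieT (G.act a) (G.rho a) (G.dCov w) l =
      altL (fun x l' => G.tor a x (w l')) l := by
  induction l generalizing w with
  | nil => simp [dCov, kos, lieT, altL, rep]
  | cons y l ih =>
    have e1 : (fun l' => G.lieT (G.act a) (G.rho a) w (y :: l')) =
        fun l' => G.lieT (G.act a) (G.rho a) (fun l'' => w (y :: l'')) l' -
          w (G.vbr (G.rho a) y :: l') := by
      ext l'
      simp only [lieT, rep]
      abel
    have e2 := h.rep_commutator (G.vbr y) (G.vbr (G.rho a)) l
    have e3 : (fun z => G.vbr (G.rho a) (G.vbr y z) - G.vbr y (G.vbr (G.rho a) z)) =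
        G.vbr (G.vbr (G.rho a) y) := by
      ext z
      rw [G.vbr_jacobi (G.rho a) y z]
      abel
    rw [e3] at e2
    rw [dCov_cons, e1]
    have e4 := ih (h.cons y)
    have e5 : rep (G.vbr y) (G.lieT (G.act a) (G.rho a) w) l = _ := rep_sub ..
    simp only [altL, ← e4, dCov_sub]
    rw [lieT, e5]
    simp only [lieT, rep, dCov_cons, map_sub, map_rep, rep_sub, ← e2, tor_apply]
    abel

/-! Weil cochains, as functions of lists. -/

/-- The Weil cochains, as functions `c(α ‖ β)(X)` of lists. -/
structure ListWeil (c : List S → List S → List T → N) : Prop where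
  form : ∀ α β, IsAlt C (c α β)
  symm : ∀ α X, IsSym C fun β => c α β X
  alt : ∀ β X, IsAlt K fun α => c α β X
  leibniz : ∀ (f : C) a α β X, c ((f • a) :: α) β X =
    f • c (a :: α) β X + G.dWedge f (c α (a :: β)) X

/-- The Lie derivative along `a` of forms with values in symmetric functions. -/
def lieS (a : S) : Module.End K (List S → List T → N) where
  toFun γ β X := G.lieT (G.act a) (G.rho a) (γ β) X - rep (G.br a) (fun β' => γ β' X) β
  map_add' γ γ' := by
    ext β X
    have e : rep (G.vbr (G.rho a)) (γ β + γ' β) X = _ := rep_add ..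
    simp only [lieT, Pi.add_apply, map_add, rep_add, e]
    abel
  map_smul' r γ := by
    ext β X
    have e : rep (G.vbr (G.rho a)) (r • γ β) X = _ := rep_smul ..
    simp only [lieT, Pi.smul_apply, map_smul, rep_smul, smul_sub, e, RingHom.id_apply]

theorem lieS_apply (a : S) (γ : List S → List T → N) (β : List S) (X : List T) :
    G.lieS a γ β X =
      G.lieT (G.act a) (G.rho a) (γ β) X - rep (G.br a) (fun β' => γ β' X) β := rfl

/-- The sum of the Lie derivative terms and of the bracket terms of the simplicial differential. -/
def kz (c : List S → List S → List T → N) : List S → List S → List T → N :=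
  kos G.lieS (fun a => G.br a) c

theorem kz_cons (c : List S → List S → List T → N) (a : S) (α β : List S) (X : List T) :
    G.kz c (a :: α) β X = G.lieS a (c α) β X - rep (G.br a) (fun α' => c α' β X) α -
      G.kz (fun α' => c (a :: α')) α β X := by
  rw [← rep_apply (G.br a) (fun α' => c α' β), ← rep_apply (G.br a) c]
  rfl

theorem kz_nil (c : List S → List S → List T → N) (β : List S) (X : List T) :
    G.kz c [] β X = 0 := rfl

theorem kz_add (c c' : List S → List S → List T → N) (α β : List S) (X : List T) :
    G.kz (fun α β X => c α β X + c' α β X) α β X = G.kz c α β X + G.kz c' α β X :=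
  congrFun (congrFun (kos_add G.lieS (fun a => G.br a) c c' α) β) X

theorem kz_sub (c c' : List S → List S → List T → N) (α β : List S) (X : List T) :
    G.kz (fun α β X => c α β X - c' α β X) α β X = G.kz c α β X - G.kz c' α β X :=
  congrFun (congrFun (kos_sub G.lieS (fun a => G.br a) c c' α) β) X

theorem kz_neg (c : List S → List S → List T → N) (α β : List S) (X : List T) :
    G.kz (fun α β X => - c α β X) α β X = -G.kz c α β X :=
  congrFun (congrFun (kos_neg G.lieS (fun a => G.br a) c α) β) X

/-- The contraction term of the simplicial differential. -/
def ctr (c : List S → List S → List T → N) (α β : List S) (X : List T) : N :=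
  symL (fun b β' => c α β' (G.rho b :: X)) β

/-- The simplicial differential. -/
def delta (c : List S → List S → List T → N) (α β : List S) (X : List T) : N :=
  (-1 : ℤ) ^ β.length • (G.kz c α β X - G.ctr c α β X)

/-- The correction term of the exterior covariant derivative. -/
def cor (c : List S → List S → List T → N) (α β : List S) (X : List T) : N :=
  symL (fun b β' => c (b :: α) β' X) β

/-- The exterior covariant derivative of Weil cochains. -/
def cov (c : List S → List S → List T → N) (α β : List S) (X : List T) : N :=
  (-1 : ℤ) ^ β.length • (G.dCov (c α β) X - cor c α β X)

/-- The exterior product with the invariance form. -/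
def wedge (c : List S → List S → List T → N) (α β : List S) (X : List T) : N :=
  altL (fun a α' => altL (fun x X' => G.tor a x (c α' β X')) X) α +
    symL (fun b β' => G.theta b (c α β' X)) β

/-! The Leibniz rules. -/

theorem kz_smul (f : C) (c : List S → List S → List T → N) (α β : List S) (X : List T) :
    G.kz (fun α β X => f • c α β X) α β X = f • G.kz c α β X +
      altL (fun a α' => G.der (G.rho a) f • c α' β X) α := by
  induction α generalizing c with
  | nil => simp [kz_nil, altL]
  | cons a α ih =>
    simp only [kz_cons, ih, lieS_apply, lieT, rep_smul, act_smul, altL]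
    module

theorem lieS_dWedge (a b : S) (f : C) (γ : List S → List T → N) (β : List S) (X : List T) :
    G.lieS a (fun β X => G.dWedge f (γ (b :: β)) X) β X =
      G.dWedge (G.der (G.rho a) f) (γ (b :: β)) X + G.dWedge f (G.lieS a γ (b :: β)) X +
        G.dWedge f (γ (G.br a b :: β)) X := by
  have e : G.lieT (G.act a) (G.rho a) (fun X => G.dWedge f (γ (b :: β)) X) X = _ :=
    G.lieT_dWedge (G.act_smul a) ..
  have e2 : G.lieS a γ (b :: β) = fun X => G.lieT (G.act a) (G.rho a) (γ (b :: β)) X -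
      (γ (G.br a b :: β) X + rep (G.br a) (fun β' => γ (b :: β') X) β) := by
    ext X
    rw [lieS_apply, rep]
  rw [lieS_apply, e, e2, dWedge_sub, dWedge_add, ← dWedge_rep]
  abel

theorem kz_dWedge (b : S) (f : C) (c : List S → List S → List T → N) (α β : List S)
    (X : List T) : G.kz (fun α β X => G.dWedge f (c α (b :: β)) X) α β X =
      altL (fun a α' => G.dWedge (G.der (G.rho a) f) (c α' (b :: β)) X +
        G.dWedge f (c α' (G.br a b :: β)) X) α + G.dWedge f (G.kz c α (b :: β)) X := by
  induction α generalizing c with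
  | nil =>
    have : G.kz c [] (b :: β) = fun _ => 0 := rfl
    rw [this]
    simp [kz_nil, altL, dWedge, altL_zero]
  | cons a α ih =>
    have e : G.kz c (a :: α) (b :: β) = fun X => _ := funext fun X => G.kz_cons c a α (b :: β) X
    rw [kz_cons, lieS_dWedge, ih, e, dWedge_sub, dWedge_sub, ← dWedge_rep, altL]
    abel

theorem rep_br_smul {γ : List S → N} (h : IsSym C γ) (f : C) (a : S) (β : List S) :
    rep (G.br (f • a)) γ β = f • rep (G.br a) γ β -
      symL (fun b β' => G.der (G.rho b) f • γ (a :: β')) β := by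
  have h1 : ⇑(G.br (f • a)) = fun z => f • G.br a z - G.der (G.rho z) f • a :=
    funext fun z => G.br_smul_left a z f
  rw [h1, h.rep_sub_fun, h.rep_smul_fun, h.rep_eq (fun z => G.der (G.rho z) f • a)]
  simp only [h.smul_cons]

theorem lieS_smul {γ : List S → List T → N} (hf : ∀ β, IsAlt C (γ β))
    (hs : ∀ X, IsSym C fun β => γ β X) (f : C) (a : S) (β : List S) (X : List T) :
    G.lieS (f • a) γ β X = f • G.lieS a γ β X +
      symL (fun b β' => G.der (G.rho b) f • γ (a :: β') X) β +
        G.dWedge f (fun X' => γ β (G.rho a :: X')) X := by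
  simp only [lieS_apply, lieT, G.rep_br_smul (hs X), map_smul, LinearMap.smul_apply,
    G.rep_vbr_smul (hf β)]
  module

theorem rep_br_smul_of_leibniz {c : List S → List S → List T → N} (hc : G.ListWeil c) (f : C)
    (a : S) (α β : List S) (X : List T) :
    rep (G.br (f • a)) (fun α' => c α' β X) α = f • rep (G.br a) (fun α' => c α' β X) α +
      altL (fun b α' => G.dWedge f (c α' (G.br a b :: β)) X -
        G.der (G.rho b) f • c (a :: α') β X -
        G.dWedge (G.der (G.rho b) f) (c α' (a :: β)) X) α := by
  have h1 : ⇑(G.br (f • a)) = fun z => f • G.br a z - G.der (G.rho z) f • a :=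
    funext fun z => G.br_smul_left a z f
  have h := hc.alt β X
  rw [h1, h.rep_sub_fun, h.rep_eq (fun z => f • G.br a z),
    h.rep_eq (fun z => G.der (G.rho z) f • a), h.rep_eq (G.br a)]
  simp only [hc.leibniz, altL_add, altL_sub, altL_smul]
  abel

theorem dWedge_contract (f : C) {c : List T → N} (x : T) (X : List T) :
    G.dWedge f (fun X' => c (x :: X')) X = G.der x f • c X - G.dWedge f c (x :: X) := by
  rw [dWedge_cons]; abel

theorem kz_ctr_leibniz {c : List S → List S → List T → N} (hc : G.ListWeil c) (f : C)
    (a : S) (α β : List S) (X : List T) :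
    G.kz c ((f • a) :: α) β X - G.ctr c ((f • a) :: α) β X =
      f • (G.kz c (a :: α) β X - G.ctr c (a :: α) β X) -
        G.dWedge f (fun X => G.kz c α (a :: β) X - G.ctr c α (a :: β) X) X := by
  have e1 : (fun α' => c ((f • a) :: α')) = fun α β X =>
      f • c (a :: α) β X + G.dWedge f (c α (a :: β)) X := by
    ext α β X
    rw [hc.leibniz]
  have e3 : ∀ b l, G.dWedge f (c l (G.br b a :: β)) X = -G.dWedge f (c l (G.br a b :: β)) X := by
    intro b l
    rw [← dWedge_neg, G.br_skew b a]
    congr 1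
    ext X'
    exact (hc.symm l X').neg_cons ..
  rw [kz_cons, G.lieS_smul (hc.form α) (hc.symm α), G.rep_br_smul_of_leibniz hc, e1, kz_add,
    kz_smul, kz_dWedge, kz_cons]
  simp only [e3, ctr, hc.leibniz, dWedge_sub, dWedge_symL, dWedge_cons, symL_add, symL_sub,
    symL_smul, smul_sub, altL_add, altL_sub, altL_neg]
  simp only [symL, dWedge_contract, symL_sub]
  abel

theorem zsmul_length_cons (a : S) (β : List S) (s : N) :
    (-1 : ℤ) ^ (a :: β).length • s = -((-1 : ℤ) ^ β.length • s) := by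
  rw [List.length_cons, pow_succ, mul_neg_one, neg_smul]

theorem delta_leibniz {c : List S → List S → List T → N} (hc : G.ListWeil c) (f : C)
    (a : S) (α β : List S) (X : List T) :
    G.delta c ((f • a) :: α) β X = f • G.delta c (a :: α) β X +
      G.dWedge f (G.delta c α (a :: β)) X := by
  have e : G.delta c α (a :: β) = fun X => _ := funext fun X => zsmul_length_cons a β _
  rw [e, delta, delta, G.kz_ctr_leibniz hc, dWedge_neg, dWedge_zsmul, smul_sub, smul_comm f]
  abel

theorem cov_leibniz {c : List S → List S → List T → N} (hc : G.ListWeil c) (f : C)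
    (a : S) (α β : List S) (X : List T) :
    G.cov c ((f • a) :: α) β X = f • G.cov c (a :: α) β X +
      G.dWedge f (G.cov c α (a :: β)) X := by
  have e : G.cov c α (a :: β) = fun X => _ := funext fun X => zsmul_length_cons a β _
  have e1 : c ((f • a) :: α) β = fun X => f • c (a :: α) β X + G.dWedge f (c α (a :: β)) X :=
    funext fun X => hc.leibniz f a α β X
  have e3 : ∀ b β', c (b :: (f • a) :: α) β' X =
      f • c (b :: a :: α) β' X - G.dWedge f (c (b :: α) (a :: β')) X := by
    intro b β'
    have e5 : c (a :: b :: α) β' X = -c (b :: a :: α) β' X := (hc.alt β' X).swap ..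
    rw [(hc.alt β' X).swap, hc.leibniz, e5, smul_neg]
    abel
  have e6 : G.dCov (fun X => G.dWedge f (c α (a :: β)) X) X = _ := G.dCov_dWedge ..
  rw [e, cov, cov, e1, dWedge_neg, dWedge_zsmul, dCov_add, dCov_smul, e6, smul_comm f]
  rw [← smul_neg, ← smul_add]
  congr 1
  simp only [cor, e3, dWedge_sub, dWedge_symL, symL_sub, symL_smul, smul_sub]
  simp only [symL]
  abel

theorem wedge_leibniz {c : List S → List S → List T → N} (hc : G.ListWeil c) (f : C)
    (a : S) (α β : List S) (X : List T) :
    G.wedge c ((f • a) :: α) β X = f • G.wedge c (a :: α) β X +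
      G.dWedge f (G.wedge c α (a :: β)) X := by
  have e : ∀ (b : S) (w : List T → N), altL (fun x X' => G.tor b x (G.dWedge f w X')) X =
      -G.dWedge f (altL fun x X' => G.tor b x (w X')) X := by
    intro b w
    simp only [dWedge, map_altL, map_smul, ← altL_smul]
    exact altL_comm (fun x z X' => G.der z f • G.tor b x (w X')) X
  simp only [wedge, altL, hc.leibniz, map_add, map_smul, altL_add, altL_smul, symL_add,
    symL_smul, e, tor_smul_left]
  have e1 : G.wedge c α (a :: β) = fun X =>
      altL (fun b α' => altL (fun x X' => G.tor b x (c α' (a :: β) X')) X) α +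
      (G.theta a (c α β X) + symL (fun b β' => G.theta b (c α (a :: β') X)) β) := rfl
  have e2 : ∀ (b : S) (w : List T → N), G.dWedge f (fun X' => G.theta b (w X')) X =
      G.theta b (G.dWedge f w X) := by
    intro b w
    simp only [dWedge, map_altL, map_smul]
  simp only [e1, dWedge_add, dWedge_symL, dWedge_altL, altL_neg, e2]
  simp only [dWedge, map_altL, map_smul]
  module

end Calculus

theorem symL_isAlt_param {U : Type*} {R A P : Type*} [CommRing R] [AddCommGroup A] [Module R A]
    [AddCommGroup P] [Module R P] {F : U → List U → List A → P} (h : ∀ z u, IsAlt R (F z u))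
    (u : List U) : IsAlt R fun l => symL (fun z u' => F z u' l) u := by
  simp only [← symL_apply]
  exact symL_mem (altGroup R A P) h u

theorem altL_isAlt_param {U : Type*} {R A P : Type*} [CommRing R] [AddCommGroup A] [Module R A]
    [AddCommGroup P] [Module R P] {F : U → List U → List A → P} (h : ∀ z u, IsAlt R (F z u))
    (u : List U) : IsAlt R fun l => altL (fun z u' => F z u' l) u := by
  simp only [← altL_apply]
  exact altL_mem (altGroup R A P) h u

theorem altL_isSym_param {U : Type*} {R A P : Type*} [CommRing R] [AddCommGroup A] [Module R A]
    [AddCommGroup P] [Module R P] {F : U → List U → List A → P} (h : ∀ z u, IsSym R (F z u))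
    (u : List U) : IsSym R fun l => altL (fun z u' => F z u' l) u := by
  simp only [← altL_apply]
  exact altL_mem (symGroup R A P) h u

theorem rep_isAlt_param {U : Type*} {R A P : Type*} [CommRing R] [AddCommGroup A] [Module R A]
    [AddCommGroup P] [Module R P] (g : U → U) {F : List U → List A → P}
    (h : ∀ u, IsAlt R (F u)) (u : List U) : IsAlt R fun l => rep g (fun u' => F u' l) u := by
  simp only [← rep_apply]
  exact rep_mem (altGroup R A P) h u

theorem rep_isSym_param {U : Type*} {R A P : Type*} [CommRing R] [AddCommGroup A] [Module R A]
    [AddCommGroup P] [Module R P] (g : U → U) {F : List U → List A → P}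
    (h : ∀ u, IsSym R (F u)) (u : List U) : IsSym R fun l => rep g (fun u' => F u' l) u := by
  simp only [← rep_apply]
  exact rep_mem (symGroup R A P) h u

namespace Calculus

set_option linter.unusedSectionVars false

variable {K C S T N : Type*} [CommRing K] [CommRing C] [Algebra K C]
    [AddCommGroup S] [Module K S] [Module C S] [AddCommGroup T] [Module K T] [Module C T]
    [AddCommGroup N] [Module K N] [Module C N]
    [IsScalarTower K C S] [IsScalarTower K C T] [IsScalarTower K C N]
    (G : Calculus K C S T N)

/-! The operators preserve Weil cochains. -/

theorem rho_restrict (r : K) (a : S) : G.rho (r • a) = r • G.rho a := by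
  rw [← algebraMap_smul C r a, map_smul, algebraMap_smul]

theorem act_restrict (r : K) (a : S) (s : N) : G.act (r • a) s = r • G.act a s := by
  rw [← algebraMap_smul C r a, map_smul, LinearMap.smul_apply, algebraMap_smul]

theorem nab_restrict (r : K) (x : T) (s : N) : G.nab (r • x) s = r • G.nab x s := by
  rw [← algebraMap_smul C r x, map_smul, LinearMap.smul_apply, algebraMap_smul]

theorem tor_restrict (r : K) (a : S) (x : T) (s : N) : G.tor (r • a) x s = r • G.tor a x s := by
  simp only [tor_apply, act_restrict, rho_restrict, map_smul, LinearMap.smul_apply, nab_restrict,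
    smul_sub, smul_add]

theorem lieS_form (a : S) {γ : List S → List T → N} (hγ : ∀ β, IsAlt C (γ β)) (β : List S) :
    IsAlt C (G.lieS a γ β) := by
  exact (G.lieT_isAlt (G.act_smul a) (hγ β)).sub (rep_isAlt_param (G.br a) hγ β)

theorem lieS_symm (a : S) {γ : List S → List T → N} (hγ : ∀ X, IsSym C fun β => γ β X)
    (X : List T) : IsSym C fun β => G.lieS a γ β X := by
  have hr : ∀ X, IsSym K fun β => γ β X := fun X => (hγ X).restrict
  have h1 : IsSym K fun β => rep (G.vbr (G.rho a)) (γ β) X := rep_isSym_param _ hr X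
  refine ((((hr X).map (G.act a)).sub h1).sub
    (rep_isSym (G.br a) (hr X))).of_smul_cons fun f b r => ?_
  have e : γ ((f • b) :: r) = fun X => f • γ (b :: r) X := funext fun X => (hγ X).smul_cons ..
  simp only [e, (hγ X).smul_cons, act_smul, rep, rep_smul, br_smul, (hγ X).add_cons]
  module

theorem kz_form {c : List S → List S → List T → N} (hc : ∀ α β, IsAlt C (c α β))
    (α β : List S) : IsAlt C (G.kz c α β) :=
  kos_mem G.lieS (fun a => G.br a)
    ({ carrier := {γ | ∀ β, IsAlt C (γ β)}
       zero_mem' := fun _ => IsAlt.zero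
       add_mem' := fun h h' β => (h β).add (h' β)
       neg_mem' := fun h β => (h β).neg } : AddSubgroup (List S → List T → N))
    (fun a _ h => G.lieS_form a h) hc α β

theorem kz_symm {c : List S → List S → List T → N} (hc : ∀ α X, IsSym C fun β => c α β X)
    (α : List S) (X : List T) : IsSym C fun β => G.kz c α β X :=
  isSym_pi.1 (kos_mem G.lieS (fun a => G.br a) (symGroup C S (List T → N))
    (fun a _ h => isSym_pi.2 (G.lieS_symm a (isSym_pi.1 h))) (fun α => isSym_pi.2 (hc α)) α) X

theorem kz_alt {c : List S → List S → List T → N} (hc : G.ListWeil c) (β : List S)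
    (X : List T) : IsAlt K fun α => G.kz c α β X := by
  refine isAlt_pi.1 (isAlt_pi.1 (kos_isAlt G.lieS G.br G.br_self
    (isAlt_pi.2 fun β => isAlt_pi.2 fun X => hc.alt β X) ?_ ?_) β) X
  · intro a b α
    ext β X
    have e1 := (hc.symm α X).rep_add_fun (G.br a) (G.br b) β
    have e2 := (hc.form α β).rep_add_fun (G.vbr (G.rho a)) (G.vbr (G.rho b)) X
    simp only [← LinearMap.add_apply, ← map_add] at e1 e2
    simp only [Pi.add_apply, lieS_apply, lieT, e1, e2]
    rw [map_add, LinearMap.add_apply]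
    abel
  · intro r a α
    ext β X
    have hs : IsSym K fun β => c α β X := (hc.symm α X).restrict
    have hf : IsAlt K (c α β) := (hc.form α β).restrict
    have e1 : rep (G.br (r • a)) (fun β => c α β X) β =
        r • rep (G.br a) (fun β => c α β X) β := by
      rw [map_smul]
      exact hs.rep_smul_fun r (G.br a) β
    have e2 : rep (G.vbr (r • G.rho a)) (c α β) X =
        r • rep (G.vbr (G.rho a)) (c α β) X := by
      rw [map_smul]
      exact hf.rep_smul_fun r (G.vbr (G.rho a)) X
    simp only [Pi.smul_apply, lieS_apply, lieT, e1, e2, rho_restrict, act_restrict, smul_sub]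

theorem delta_weil {c : List S → List S → List T → N} (hc : G.ListWeil c) :
    G.ListWeil (G.delta c) where
  form α β := (altGroup C T N).zsmul_mem
    ((G.kz_form hc.form α β).sub (symL_isAlt_param (fun _ _ => (hc.form _ _).cons _) β)) _
  symm α X := ((G.kz_symm hc.symm α X).sub (symL_isSym
    (fun b b' β => by rw [map_add, (hc.form α β).add_cons])
    (fun f b β => by rw [map_smul, (hc.form α β).smul_cons]) fun b => hc.symm _ _)).sign
  alt β X := (altGroup K S N).zsmul_mem
    ((G.kz_alt hc β X).sub (symL_isAlt_param (fun _ _ => hc.alt _ _) β)) _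
  leibniz f a α β X := G.delta_leibniz hc f a α β X

theorem cov_weil {c : List S → List S → List T → N} (hc : G.ListWeil c) :
    G.ListWeil (G.cov c) where
  form α β := (altGroup C T N).zsmul_mem
    ((G.dCov_isAlt (hc.form α β)).sub (symL_isAlt_param (fun _ _ => hc.form _ _) β)) _
  symm α X := by
    refine IsSym.sign (IsSym.of_smul_cons (K := K) (IsSym.sub ?_ ?_) ?_)
    · exact (isSym_pi.2 fun X => (hc.symm α X).restrict (K := K)).map
        ((LinearMap.proj X).comp (kosHom G.nab fun x => G.vbr x))
    · exact symL_isSym (fun b b' β => (hc.alt β X).add_cons ..)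
        (fun f b β => (hc.alt β X).smul_cons ..) fun b => (hc.symm _ X).restrict
    · intro f b r
      have e : c α ((f • b) :: r) = fun X => f • c α (b :: r) X :=
        funext fun X => (hc.symm α X).smul_cons ..
      simp only [e, dCov_smul, cor, symL, hc.leibniz, (hc.symm _ X).smul_cons, symL_smul]
      module
  alt β X := by
    refine (altGroup K S N).zsmul_mem (IsAlt.sub ?_ ?_) _
    · exact (isAlt_pi.2 fun X => hc.alt β X).map
        ((LinearMap.proj X).comp (kosHom G.nab fun x => G.vbr x))
    · exact symL_isAlt_param (fun b β => (hc.alt β X).cons b) β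
  leibniz f a α β X := G.cov_leibniz hc f a α β X

theorem wedge_weil {c : List S → List S → List T → N} (hc : G.ListWeil c) :
    G.ListWeil (G.wedge c) where
  form α β := by
    refine IsAlt.add (altL_isAlt_param (fun a α' => altL_isAlt ?_ ?_ ?_) α)
      (symL_isAlt_param (fun b β' => (hc.form α β').map (G.theta b)) β)
    · exact fun x y l => G.tor_add_right a x y _
    · exact fun f x l => G.tor_smul_right f a x _
    · exact fun x => (hc.form α' β).map (G.tor a x)
  symm α X := IsSym.add
    (altL_isSym_param (fun a α' => altL_isSym_param (fun x X' => (hc.symm α' X').map (G.tor a x)) X) α)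
    (symL_isSym (fun b b' β => G.theta_add ..) (fun f b β => G.theta_smul ..)
      fun b => (hc.symm α X).map (G.theta b))
  alt β X := by
    refine IsAlt.add (altL_isAlt ?_ ?_ fun a => altL_isAlt_param (fun x X' => ?_) X)
      (symL_isAlt_param (fun b β' => ?_) β)
    · intro a b l
      simp only [tor_add_left, altL_add]
    · intro r a l
      simp only [tor_restrict, altL_smul]
    · exact (hc.alt β X').map ((G.tor a x).restrictScalars K)
    · exact (hc.alt β' X).map ((G.theta b).restrictScalars K)
  leibniz f a α β X := G.wedge_leibniz hc f a α β X

/-! The commutator. -/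

theorem dCov_kz {c : List S → List S → List T → N} (hc : ∀ α β, IsAlt C (c α β))
    (α β : List S) (X : List T) :
    G.dCov (G.kz c α β) X - G.kz (fun α β => G.dCov (c α β)) α β X =
      altL (fun a α' => altL (fun x X' => G.tor a x (c α' β X')) X) α := by
  induction α generalizing c with
  | nil =>
    have e : G.kz c [] β = fun _ => 0 := rfl
    rw [e, kz_nil, sub_zero]
    exact kos_zero ..
  | cons a α ih =>
    have e1 : G.kz c (a :: α) β = fun X => _ := funext fun X => G.kz_cons c a α β X
    have e2 : G.lieS a (c α) β = fun X => _ := funext fun X => G.lieS_apply a (c α) β X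
    have e3 : ∀ γ : List S → List T → N, ∀ u, G.dCov (fun X => rep (G.br a)
        (fun β' => γ β' X) u) X = rep (G.br a) (fun β' => G.dCov (γ β') X) u :=
      fun γ u => kos_rep ..
    rw [altL, ← G.dCov_lieT a (hc α β), ← ih fun α β => hc (a :: α) β, e1, dCov_sub, dCov_sub, e2,
      dCov_sub, kz_cons, lieS_apply, e3 (c α), e3 fun α' => c α' β]
    abel

theorem cor_kz {c : List S → List S → List T → N}
    (hc : ∀ β X, IsAlt K fun α => c α β X) (α β : List S) (X : List T) :
    cor (G.kz c) α β X + G.kz (cor c) α β X =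
      symL (fun b β' => G.lieS b (c α) β' X) β := by
  have aux : G.kz (cor c) α β X = symL (fun b β' => rep (G.br b) (fun α' => c α' β' X) α +
      G.kz (fun α' => c (b :: α')) α β' X) β := by
    induction α generalizing c with
    | nil => simp [kz_nil, rep, symL_zero]
    | cons a α ih =>
      have e1 : (fun α' => cor c (a :: α')) = fun α' β X =>
          -cor (fun α'' => c (a :: α'')) α' β X := by
        ext α' β X
        simp only [cor, (hc _ X).swap _ a, symL_neg]
      have e2 : ∀ b, (fun α' => c (a :: b :: α')) = fun α' β X => -c (b :: a :: α') β X := by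
        intro b
        ext α' β X
        exact (hc β X).swap ..
      rw [kz_cons, e1, kz_neg, ih fun β X => (hc β X).cons a, lieS_apply]
      have e3 : ∀ b l, c (G.br b a :: α) l X = -c (G.br a b :: α) l X := by
        intro b l
        rw [G.br_skew b a]
        exact (hc l X).neg_cons ..
      have e4 : rep (G.br a) (fun β' => cor c α β' X) β = _ := rep_symL ..
      have e5 : rep (G.vbr (G.rho a)) (cor c α β) X = _ := rep_symL_comm ..
      have e6 : rep (G.br a) (fun α' => cor c α' β X) α = _ := rep_symL_comm ..
      rw [lieT, e4, e5, e6, cor, map_symL]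
      simp only [rep, kz_cons, lieS_apply, lieT, e2, e3, kz_neg, symL_add, symL_sub, symL_neg]
      abel
  rw [aux, cor, ← symL_add]
  congr 1
  ext b β'
  rw [kz_cons]
  abel

theorem dCov_ctr (c : List S → List S → List T → N) (α β : List S) (X : List T) :
    G.dCov (G.ctr c α β) X + G.ctr (fun α β => G.dCov (c α β)) α β X =
      symL (fun b β' => G.lieT (G.nab (G.rho b)) (G.rho b) (c α β') X) β := by
  have e : G.dCov (G.ctr c α β) X = _ := kos_symL ..
  rw [e, ctr, ← symL_add]
  congr 1
  ext b β'
  rw [dCov_cons]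
  exact add_sub_cancel ..

theorem dCov_zsmul (n : ℤ) (w : List T → N) (l : List T) :
    G.dCov (fun l' => n • w l') l = n • G.dCov w l :=
  congrFun (map_zsmul (kosHom G.nab fun x => G.vbr x) n w) l

theorem kz_sign (c : List S → List S → List T → N) (α β : List S) (X : List T) :
    G.kz (fun α β X => (-1 : ℤ) ^ β.length • c α β X) α β X =
      (-1 : ℤ) ^ β.length • G.kz c α β X := by
  induction α generalizing c with
  | nil => simp [kz_nil]
  | cons a α ih =>
    simp only [kz_cons, ih, lieS_apply, lieT, rep_sign, rep_smul, map_zsmul, smul_sub]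

theorem cov_delta_sub_delta_cov {c : List S → List S → List T → N} (hc : G.ListWeil c)
    (α β : List S) (X : List T) :
    G.cov (G.delta c) α β X - G.delta (G.cov c) α β X = G.wedge c α β X := by
  have hs : ∀ s : N, (-1 : ℤ) ^ β.length • (-1 : ℤ) ^ β.length • s = s := by
    intro s
    rw [smul_smul, ← mul_pow]
    simp
  have h1 : G.cov (G.delta c) α β X =
      G.dCov (G.kz c α β) X - G.dCov (G.ctr c α β) X + cor (G.kz c) α β X -
        cor (G.ctr c) α β X := by
    have e : G.dCov (G.delta c α β) X = _ := G.dCov_zsmul ..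
    have e2 : cor (G.delta c) α β X = _ := symL_sign ..
    rw [cov, e, e2, sub_neg_eq_add, ← smul_add, hs, dCov_sub, symL_sub]
    simp only [cor]
    abel
  have h2 : G.delta (G.cov c) α β X =
      G.kz (fun α β => G.dCov (c α β)) α β X - G.kz (cor c) α β X +
        G.ctr (fun α β => G.dCov (c α β)) α β X - G.ctr (cor c) α β X := by
    have e : G.kz (G.cov c) α β X = _ := G.kz_sign ..
    have e2 : G.ctr (G.cov c) α β X = _ := symL_sign ..
    rw [delta, e, e2, sub_neg_eq_add, ← smul_add, hs, kz_sub, symL_sub]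
    simp only [ctr]
    abel
  have h3 : cor (G.ctr c) α β X = G.ctr (cor c) α β X :=
    symL_comm (fun b b' β' => c (b :: α) β' (G.rho b' :: X)) β
  have h4 := (hc.symm α X).symL_rep_eq_zero (fun a b => G.br a b) G.br_skew β
  have h5 := G.cor_kz hc.alt α β X
  have h6 := G.dCov_ctr c α β X
  have h7 := G.dCov_kz hc.form α β X
  have h8 : symL (fun b β' => G.theta b (c α β' X)) β =
      symL (fun b β' => G.lieS b (c α) β' X) β -
        symL (fun b β' => G.lieT (G.nab (G.rho b)) (G.rho b) (c α β') X) β := by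
    rw [← sub_zero (symL _ β), ← h4, ← symL_sub, ← symL_sub]
    congr 1
    ext b β'
    rw [theta_apply, lieS_apply, lieT, lieT]
    abel
  rw [h1, h2, h3, wedge, h8, ← h5, ← h6, ← h7]
  abel

end Calculus

/-! ### Lists and tuples -/

section Tuples

variable {S T N : Type*} [AddCommGroup N]

theorem removeNth_succ {m : ℕ} (i : Fin (m + 1)) (x : Fin (m + 2) → S) :
    i.succ.removeNth x = Fin.cons (x 0) (i.removeNth (Fin.tail x)) := by
  ext j
  refine Fin.cases ?_ (fun j => ?_) j
  · simp [Fin.removeNth]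
  · simp [Fin.removeNth, Fin.tail]

theorem ofFn_eq_cons {m : ℕ} (x : Fin (m + 1) → S) :
    List.ofFn x = x 0 :: List.ofFn (Fin.tail x) := List.ofFn_succ

theorem ofFn_cons {m : ℕ} (y : S) (x : Fin m → S) :
    List.ofFn (Fin.cons y x : Fin (m + 1) → S) = y :: List.ofFn x := by
  rw [ofFn_eq_cons, Fin.cons_zero, Fin.tail_cons]

theorem altSum_succ {m : ℕ} (F : S → (Fin (m + 1) → S) → N) (x : Fin (m + 2) → S) :
    altSum F x = F (x 0) (Fin.tail x) -
      altSum (fun z x' => F z (Fin.cons (x 0) x')) (Fin.tail x) := by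
  rw [altSum, Fin.sum_univ_succ, sub_eq_add_neg, altSum, ← Finset.sum_neg_distrib]
  congr 1
  · simp
  · refine Finset.sum_congr rfl fun i _ => ?_
    rw [removeNth_succ, Fin.val_succ, pow_succ, mul_neg_one, neg_smul]
    rfl

theorem altSum_eq_altL {m : ℕ} (F : S → List S → N) (x : Fin (m + 1) → S) :
    altSum (fun y x' => F y (List.ofFn x')) x = altL F (List.ofFn x) := by
  induction m generalizing F with
  | zero => simp [altSum, altL]
  | succ m ih =>
    rw [altSum_succ, ofFn_eq_cons x, altL, ← ih]
    simp only [ofFn_cons]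

theorem sum_removeNth_eq_symL {m : ℕ} (F : S → List S → N) (x : Fin (m + 1) → S) :
    ∑ i, F (x i) (List.ofFn (i.removeNth x)) = symL F (List.ofFn x) := by
  induction m generalizing F with
  | zero => simp [symL]
  | succ m ih =>
    rw [Fin.sum_univ_succ, ofFn_eq_cons x, symL, ← ih]
    simp only [removeNth_succ, ofFn_cons, Fin.removeNth_zero, Fin.tail]

theorem update_succ {m : ℕ} (x : Fin (m + 1) → S) (i : Fin m) (y : S) :
    Function.update x i.succ y = Fin.cons (x 0) (Function.update (Fin.tail x) i y) := by
  rw [Fin.cons_update, Fin.cons_self_tail]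

theorem sum_update_eq_rep {m : ℕ} (g : S → S) (w : List S → N) (x : Fin m → S) :
    ∑ i, w (List.ofFn (Function.update x i (g (x i)))) = rep g w (List.ofFn x) := by
  induction m generalizing w with
  | zero => simp [rep]
  | succ m ih =>
    rw [Fin.sum_univ_succ, ofFn_eq_cons x, rep, ← ih]
    congr 1
    · rw [ofFn_eq_cons]
      simp
    · simp only [update_succ, ofFn_cons]
      rfl

theorem bracketSum_succ (br : S → S → S) {w : List S → N}
    (hw : ∀ y z l, w (y :: z :: l) = -w (z :: y :: l)) {m : ℕ} (x : Fin (m + 2) → S) :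
    bracketSum br (fun x' : Fin (m + 1) → S => w (List.ofFn x')) x =
      -altSum (fun z x' => w (br (x 0) z :: List.ofFn x')) (Fin.tail x) -
        bracketSum br (fun x' : Fin m → S => w (x 0 :: List.ofFn x')) (Fin.tail x) := by
  rw [bracketSum, Fin.sum_univ_succ]
  have h0 : ∀ i : Fin (m + 1), ¬ i.castSucc < 0 := fun i => Fin.not_lt_zero _
  simp only [h0, if_false, Finset.sum_const_zero, zero_add]
  have h1 : ∀ j : Fin (m + 1), ∑ i : Fin (m + 1), (if i.castSucc < j.succ then
        (-1 : ℤ) ^ ((i : ℕ) + (j.succ : ℕ)) • w (List.ofFn (Fin.cons (br (x i.castSucc) (x j.succ))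
          (i.removeNth (j.succ.removeNth x)))) else 0) =
      -((-1 : ℤ) ^ (j : ℕ) • w (br (x 0) (Fin.tail x j) ::
        List.ofFn (j.removeNth (Fin.tail x)))) + ∑ i : Fin m, (if i.succ.castSucc < j.succ then
        (-1 : ℤ) ^ ((i.succ : ℕ) + (j.succ : ℕ)) •
          w (List.ofFn (Fin.cons (br (x i.succ.castSucc) (x j.succ))
          (i.succ.removeNth (j.succ.removeNth x)))) else 0) := by
    intro j
    rw [Fin.sum_univ_succ]
    congr 1
    rw [if_pos (by simp), ofFn_cons, removeNth_succ, Fin.removeNth_zero, Fin.tail_cons,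
      Fin.val_zero, zero_add, Fin.val_succ, pow_succ, mul_neg_one, neg_smul]
    rfl
  rw [Finset.sum_congr rfl fun j _ => h1 j, Finset.sum_add_distrib, Finset.sum_neg_distrib,
    sub_eq_add_neg]
  congr 1
  cases m with
  | zero => simp [bracketSum]
  | succ m =>
    rw [bracketSum, ← Finset.sum_neg_distrib]
    refine Finset.sum_congr rfl fun j _ => ?_
    rw [← Finset.sum_neg_distrib]
    refine Finset.sum_congr rfl fun i _ => ?_
    have h2 : i.succ.castSucc < j.succ ↔ i.castSucc < j := by
      rw [← Fin.succ_castSucc, Fin.succ_lt_succ_iff]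
    simp only [h2]
    split_ifs
    · rw [removeNth_succ, removeNth_succ, Fin.cons_zero, Fin.tail_cons, ofFn_cons, ofFn_cons,
        ofFn_cons, hw, smul_neg, Fin.val_succ, Fin.val_succ,
        show (i : ℕ) + 1 + ((j : ℕ) + 1) = i + j + 2 by ring, pow_add _ _ 2, neg_one_sq, mul_one]
      rfl
    · simp

theorem altSum_apply {U : Type*} {m : ℕ} (F : S → (Fin m → S) → U → N) (x : Fin (m + 1) → S)
    (u : U) : altSum F x u = altSum (fun y x' => F y x' u) x := by
  simp only [altSum, Finset.sum_apply, Pi.smul_apply]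

theorem bracketSum_apply {U : Type*} (br : S → S → S) {m : ℕ} (f : (Fin m → S) → U → N)
    (x : Fin (m + 1) → S) (u : U) :
    bracketSum br f x u = bracketSum br (fun x' => f x' u) x := by
  cases m with
  | zero => rfl
  | succ m =>
    simp only [bracketSum, Finset.sum_apply]
    refine Finset.sum_congr rfl fun j _ => Finset.sum_congr rfl fun i _ => ?_
    split_ifs <;> rfl

theorem altSum_add_bracketSum {K : Type*} [CommRing K] [Module K N] [AddCommGroup S] [Module K S]
    (D : S → Module.End K N) (br : S → S → S) {w : List S → N} (hw : IsAlt K w) {m : ℕ}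
    (x : Fin (m + 1) → S) :
    altSum (fun y x' => D y (w (List.ofFn x'))) x +
      bracketSum br (fun x' : Fin m → S => w (List.ofFn x')) x = kos D br w (List.ofFn x) := by
  induction m generalizing w with
  | zero => simp [altSum, bracketSum, kos, rep]
  | succ m ih =>
    rw [altSum_succ, bracketSum_succ br hw.swap, ofFn_eq_cons x, kos, ← ih (hw.cons (x 0)),
      hw.rep_eq, altSum_eq_altL fun z l => w (br (x 0) z :: l)]
    simp only [ofFn_cons]
    abel

/-! Multilinear maps of tuples and of lists. -/

variable {R : Type*} [CommRing R] [AddCommGroup S] [Module R S] [Module R N]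

theorem exists_multilinearMap (p : (List S → N) → Prop) (hp : ∀ w, p w → ∀ y, p fun l => w (y :: l))
    (hadd : ∀ w, p w → ∀ y z l, w ((y + z) :: l) = w (y :: l) + w (z :: l))
    (hsmul : ∀ w, p w → ∀ (c : R) y l, w ((c • y) :: l) = c • w (y :: l))
    {w : List S → N} (hw : p w) (n : ℕ) :
    ∃ g : MultilinearMap R (fun _ : Fin n => S) N, ⇑g = fun x => w (List.ofFn x) := by
  have h1 : ∀ (x : Fin n → S) i y z, w (List.ofFn (Function.update x i (y + z))) =
      w (List.ofFn (Function.update x i y)) + w (List.ofFn (Function.update x i z)) := by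
    intro x i y z
    induction n generalizing w with
    | zero => exact i.elim0
    | succ n ih =>
      refine Fin.cases ?_ (fun i => ?_) i
      · simp only [ofFn_eq_cons, Function.update_self, Fin.tail_update_zero, hadd w hw]
      · simp only [update_succ, ofFn_cons]
        exact ih (hp w hw (x 0)) _ _
  have h2 : ∀ (x : Fin n → S) i (c : R) y, w (List.ofFn (Function.update x i (c • y))) =
      c • w (List.ofFn (Function.update x i y)) := by
    clear h1
    intro x i c y
    induction n generalizing w with
    | zero => exact i.elim0
    | succ n ih =>
      refine Fin.cases ?_ (fun i => ?_) i
      · simp only [ofFn_eq_cons, Function.update_self, Fin.tail_update_zero, hsmul w hw]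
      · simp only [update_succ, ofFn_cons]
        exact ih (hp w hw (x 0)) _ _
  exact ⟨MultilinearMap.mk' (fun x => w (List.ofFn x)) h1 h2, rfl⟩

theorem IsAlt.perm {w : List S → N} (h : IsAlt R w) {l l' : List S} (hl : l.Perm l') :
    w l = w l' ∨ w l = -w l' := by
  induction hl generalizing w with
  | nil => exact Or.inl rfl
  | cons y _ ih => exact ih (h.cons y)
  | swap y z l => exact Or.inr (h.swap ..)
  | trans _ _ ih ih' =>
    rcases ih h with e | e <;> rcases ih' h with e' | e' <;> simp [e, e']

theorem IsSym.perm {w : List S → N} (h : IsSym R w) {l l' : List S} (hl : l.Perm l') :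
    w l = w l' := by
  induction hl generalizing w with
  | nil => rfl
  | cons y _ ih => exact ih (h.cons y)
  | swap y z l => exact h.swap ..
  | trans _ _ ih ih' => exact (ih h).trans (ih' h)

theorem IsAlt.isAlternating {w : List S → N} (h : IsAlt R w) (n : ℕ) :
    IsAlternating R fun x : Fin n → S => w (List.ofFn x) := by
  obtain ⟨g, hg⟩ := exists_multilinearMap (R := R) (IsAlt R) (fun _ h => h.cons)
    (fun _ h => h.add_cons) (fun _ h => h.smul_cons) h n
  refine ⟨{ g with map_eq_zero_of_eq' := fun x i j hij hne => ?_ }, hg⟩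
  have e : g x = w (List.ofFn x) := congrFun hg x
  refine e.trans ?_
  have hd : ¬ (List.ofFn x).Nodup := fun hn => hne (List.nodup_ofFn.1 hn hij)
  obtain ⟨y, hy⟩ := List.exists_duplicate_iff_not_nodup.2 hd
  obtain ⟨l, hl⟩ := (List.duplicate_iff_sublist.1 hy).exists_perm_append
  rcases h.perm hl with h' | h' <;> rw [h'] <;> simp [h.self]

theorem IsSym.isSymmetric {w : List S → N} (h : IsSym R w) (n : ℕ) :
    IsSymmetric R fun x : Fin n → S => w (List.ofFn x) :=
  ⟨exists_multilinearMap (R := R) (IsSym R) (fun _ h => h.cons)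
    (fun _ h => h.add_cons) (fun _ h => h.smul_cons) h n,
    fun e x => h.perm (Equiv.Perm.ofFn_comp_perm e x)⟩

theorem isAlt_of_isAlternating {n : ℕ} {w : List S → N} (h0 : ∀ l, l.length ≠ n → w l = 0)
    (h : IsAlternating R fun x : Fin n → S => w (List.ofFn x)) : IsAlt R w := by
  intro d
  induction d generalizing n w with
  | zero =>
    obtain ⟨g, hg⟩ := h
    refine ⟨fun y z r => ?_, fun c y r => ?_, fun y r => ?_⟩
    · by_cases hr : r.length + 1 = n
      · subst hr
        have := g.toMultilinearMap.cons_add r.get y z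
        simpa [hg, ofFn_cons] using this
      · simp only [h0 (_ :: r) hr, add_zero]
    · by_cases hr : r.length + 1 = n
      · subst hr
        have := g.toMultilinearMap.cons_smul r.get c y
        simpa [hg, ofFn_cons] using this
      · simp only [h0 (_ :: r) hr, smul_zero]
    · by_cases hr : r.length + 2 = n
      · subst hr
        have := g.map_eq_zero_of_eq (Fin.cons y (Fin.cons y r.get)) (i := 0) (j := 1) rfl (by simp)
        simpa [hg, ofFn_cons] using this
      · exact h0 (_ :: _ :: r) hr
  | succ d ih =>
    intro y
    cases n with
    | zero =>
      have : (fun l => w (y :: l)) = fun _ => 0 := funext fun l => h0 _ (by simp)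
      rw [this]
      exact IsAlt.zero d
    | succ n =>
      refine ih (fun l hl => h0 _ (by simpa using hl)) ?_
      obtain ⟨g, hg⟩ := h
      refine ⟨g.curryLeft y, funext fun x => ?_⟩
      rw [← ofFn_cons]
      exact congrFun hg (Fin.cons y x)

theorem isSym_of_isSymmetric {n : ℕ} {w : List S → N} (h0 : ∀ l, l.length ≠ n → w l = 0)
    (h : IsSymmetric R fun x : Fin n → S => w (List.ofFn x)) : IsSym R w := by
  intro d
  induction d generalizing n w with
  | zero =>
    obtain ⟨⟨g, hg⟩, hs⟩ := h
    refine ⟨fun y z r => ?_, fun c y r => ?_, fun y z r => ?_⟩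
    · by_cases hr : r.length + 1 = n
      · subst hr
        have := g.cons_add r.get y z
        simpa [hg, ofFn_cons] using this
      · simp only [h0 (_ :: r) hr, add_zero]
    · by_cases hr : r.length + 1 = n
      · subst hr
        have := g.cons_smul r.get c y
        simpa [hg, ofFn_cons] using this
      · simp only [h0 (_ :: r) hr, smul_zero]
    · by_cases hr : r.length + 2 = n
      · subst hr
        have h1 := hs (Equiv.swap 0 1) (Fin.cons y (Fin.cons z r.get))
        have h2 : (Fin.cons y (Fin.cons z r.get) : Fin (r.length + 2) → S) ∘ Equiv.swap 0 1 =
            Fin.cons z (Fin.cons y r.get) := by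
          ext i
          refine Fin.cases ?_ (fun i => Fin.cases ?_ (fun i => ?_) i) i
          · simp
          · have : Equiv.swap 0 1 (Fin.succ 0 : Fin (r.length + 2)) = 0 :=
              Equiv.swap_apply_right ..
            rw [Function.comp_apply, this]
            simp
          · rw [Function.comp_apply, Equiv.swap_apply_of_ne_of_ne (by simp)
              (by simp [Fin.ext_iff])]
            simp
        simp only [h2, ofFn_cons, List.ofFn_get] at h1
        exact h1.symm
      · rw [h0 (_ :: _ :: r) hr, h0 (_ :: _ :: r) hr]
  | succ d ih =>
    intro y
    cases n with
    | zero =>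
      have : (fun l => w (y :: l)) = fun _ => 0 := funext fun l => h0 _ (by simp)
      rw [this]
      exact IsSym.zero d
    | succ n =>
      refine ih (fun l hl => h0 _ (by simpa using hl)) ?_
      obtain ⟨⟨g, hg⟩, hs⟩ := h
      refine ⟨⟨g.curryLeft y, funext fun x => ?_⟩, fun e x => ?_⟩
      · rw [← ofFn_cons]
        exact congrFun hg (Fin.cons y x)
      · have h1 := hs (Equiv.Perm.decomposeFin.symm (0, e)) (Fin.cons y x)
        have h2 : (Fin.cons y x : Fin (n + 1) → S) ∘ Equiv.Perm.decomposeFin.symm (0, e) =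
            Fin.cons y (x ∘ e) := by
          ext i
          refine Fin.cases ?_ (fun i => ?_) i <;> simp
        simpa only [h2, ofFn_cons] using h1

end Tuples

section Sequences

variable {S T N : Type*} [AddCommGroup N]

/-! Sequences of maps of tuples as functions of lists. -/

/-- The extension by zero of a sequence of maps of tuples to a function of lists. -/
def listSeq {p q : ℕ} (c : WeilSeq S T N p q) (α β : List S) (X : List T) : N :=
  if h : α.length + β.length = p ∧ β.length + X.length = q then
    c α.length β.length X.length h.1 h.2 α.get β.get X.get
  else 0

theorem listSeq_of_ne {p q : ℕ} (c : WeilSeq S T N p q) {α β : List S} {X : List T}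
    (h : ¬ (α.length + β.length = p ∧ β.length + X.length = q)) : listSeq c α β X = 0 :=
  dif_neg h

theorem listSeq_ofFn {p q : ℕ} (c : WeilSeq S T N p q) {a k m : ℕ} (ha : a + k = p)
    (hm : k + m = q) (α : Fin a → S) (β : Fin k → S) (X : Fin m → T) :
    listSeq c (List.ofFn α) (List.ofFn β) (List.ofFn X) = c a k m ha hm α β X := by
  have aux : ∀ (l₁ l₂ : List S) (l₃ : List T) (e₁ : l₁.length = a) (e₂ : l₂.length = k)
      (e₃ : l₃.length = m), listSeq c l₁ l₂ l₃ = c a k m ha hm (fun i => l₁.get (i.cast e₁.symm))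
        (fun i => l₂.get (i.cast e₂.symm)) (fun i => l₃.get (i.cast e₃.symm)) := by
    intro l₁ l₂ l₃ e₁ e₂ e₃
    subst e₁ e₂ e₃
    exact dif_pos ⟨ha, hm⟩
  rw [aux _ _ _ (by simp) (by simp) (by simp)]
  simp

/-- The sequence `c` of maps of tuples is given by the function `C` of lists. -/
def Represents {p q : ℕ} (C : List S → List S → List T → N) (c : WeilSeq S T N p q) : Prop :=
  ∀ a k m ha hm α β X, c a k m ha hm α β X = C (List.ofFn α) (List.ofFn β) (List.ofFn X)

theorem listSeq_represents {p q : ℕ} (c : WeilSeq S T N p q) : Represents (listSeq c) c :=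
  fun _ _ _ ha hm α β X => (listSeq_ofFn c ha hm α β X).symm

end Sequences

/-! ### The calculus of a representation and a connection on a manifold -/

section Instances

variable {E : Type*} [NormedAddCommGroup E] [NormedSpace ℝ E]
  {H : Type*} [TopologicalSpace H] {I : ModelWithCorners ℝ E H}
  {M : Type*} [TopologicalSpace M] [ChartedSpace H M]
  {F : Type*} [NormedAddCommGroup F] [NormedSpace ℝ F]
  {V : M → Type*} [TopologicalSpace (TotalSpace F V)] [∀ x, TopologicalSpace (V x)]
  [∀ x, AddCommGroup (V x)] [∀ x, Module ℝ (V x)] [FiberBundle F V] [VectorBundle ℝ F V]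

instance sectionTower : IsScalarTower ℝ C^∞⟮I, M; ℝ⟯ Cₛ^∞⟮I; F, V⟯ :=
  ⟨fun r f s => by ext x; exact mul_smul r (f x) (s x)⟩

variable [IsManifold I ∞ M]

theorem dirDeriv_add (X Y : VField I M) (f : C^∞⟮I, M; ℝ⟯) :
    dirDeriv (X + Y) f = dirDeriv X f + dirDeriv Y f := by
  ext x
  exact map_add (mvfderiv I f x) (X x) (Y x)

theorem dirDeriv_smul (g : C^∞⟮I, M; ℝ⟯) (X : VField I M) (f : C^∞⟮I, M; ℝ⟯) :
    dirDeriv (g • X) f = g • dirDeriv X f := by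
  ext x
  exact map_smul (mvfderiv I f x) (g x) (X x)

variable [FiniteDimensional ℝ E]

theorem vbracket_add_left (X Y Z : VField I M) :
    vbracket (X + Y) Z = vbracket X Z + vbracket Y Z := by
  ext x
  exact VectorField.mlieBracket_add_left X.mdifferentiableAt Y.mdifferentiableAt

theorem vbracket_self (X : VField I M) : vbracket X X = 0 := by
  ext x
  exact congrFun (VectorField.mlieBracket_self (I := I) (V := X)) x

theorem vbracket_swap (X Y : VField I M) : vbracket X Y = -vbracket Y X := by
  ext x
  exact VectorField.mlieBracket_swap_apply

theorem vbracket_const_smul_left (r : ℝ) (X Y : VField I M) :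
    vbracket (r • X) Y = r • vbracket X Y := by
  ext x
  exact VectorField.mlieBracket_const_smul_left X.mdifferentiableAt

theorem vbracket_smul_right (X Y : VField I M) (f : C^∞⟮I, M; ℝ⟯) :
    vbracket X (f • Y) = f • vbracket X Y + dirDeriv X f • Y := by
  ext x
  have h := VectorField.mlieBracket_smul_right (I := I) (V := X) (f := f) (W := Y) (x := x)
    ((f.contMDiff x).mdifferentiableAt (by simp)) Y.mdifferentiableAt
  exact h.trans (add_comm _ _)

theorem vbracket_jacobi (X Y Z : VField I M) : vbracket X (vbracket Y Z) =
    vbracket (vbracket X Y) Z + vbracket Y (vbracket X Z) := by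
  have : CompleteSpace E := FiniteDimensional.complete ℝ E
  have : IsManifold I (minSmoothness ℝ 3) M := by
    rw [minSmoothness_of_isRCLikeNormedField]; infer_instance
  have h : ∀ Y : VField I M, ∀ y, ContMDiffAt I (I.prod 𝓘(ℝ, E)) (minSmoothness ℝ 2)
      (fun y => TotalSpace.mk' E y (Y y)) y := fun Y y => by
    rw [minSmoothness_of_isRCLikeNormedField]
    exact (Y.contMDiff y).of_le (by norm_cast)
  ext x
  exact VectorField.leibniz_identity_mlieBracket_apply (I := I) (h X x) (h Y x) (h Z x)

/-- The Lie bracket of vector fields as a bilinear map. -/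
def vbracketHom : VField I M →ₗ[ℝ] VField I M →ₗ[ℝ] VField I M :=
  LinearMap.mk₂ ℝ vbracket vbracket_add_left vbracket_const_smul_left
    (fun X Y Z => by
      rw [vbracket_swap, vbracket_add_left, vbracket_swap Y, vbracket_swap Z, neg_add, neg_neg,
        neg_neg])
    fun r X Y => by
      rw [vbracket_swap, vbracket_const_smul_left, vbracket_swap Y, smul_neg, neg_neg]

end Instances

section Algebroid

set_option linter.unusedSectionVars false

variable {E : Type*} [NormedAddCommGroup E] [NormedSpace ℝ E] [FiniteDimensional ℝ E]
  {H : Type*} [TopologicalSpace H] {I : ModelWithCorners ℝ E H}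
  {M : Type*} [TopologicalSpace M] [ChartedSpace H M] [IsManifold I ∞ M]
  {FA : Type*} [NormedAddCommGroup FA] [NormedSpace ℝ FA]
  {A : M → Type*} [TopologicalSpace (TotalSpace FA A)] [∀ x, TopologicalSpace (A x)]
  [∀ x, AddCommGroup (A x)] [∀ x, Module ℝ (A x)]
  [FiberBundle FA A] [VectorBundle ℝ FA A]
  {FV : Type*} [NormedAddCommGroup FV] [NormedSpace ℝ FV]
  {V : M → Type*} [TopologicalSpace (TotalSpace FV V)] [∀ x, TopologicalSpace (V x)]
  [∀ x, AddCommGroup (V x)] [∀ x, Module ℝ (V x)]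
  [FiberBundle FV V] [VectorBundle ℝ FV V]
  [∀ x, IsTopologicalAddGroup (V x)] [∀ x, ContinuousSMul ℝ (V x)]
  (nab : CovariantDerivative I FV V) [nab.ContMDiffCovariantDerivative ∞]
  {L : LieAlgebroid I FA A} (R : AlgebroidRep FV V L)

theorem covSec_const_smul (X : VField I M) (r : ℝ) (s : Cₛ^∞⟮I; FV, V⟯) :
    covSec nab X (r • s) = r • covSec nab X s := by
  ext x
  exact congrArg (fun φ => φ (X x))
    (nab.isCovariantDerivativeOnUniv.smul_const (a := r) (s.mdifferentiableAt))

/-- The calculus of a representation and a connection. -/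
def algebroidCalculus :
    Calculus ℝ C^∞⟮I, M; ℝ⟯ Cₛ^∞⟮I; FA, A⟯ (VField I M) Cₛ^∞⟮I; FV, V⟯ where
  der :=
    { toFun := dirDeriv
      map_add' X Y := funext fun f => dirDeriv_add X Y f
      map_smul' g X := funext fun f => dirDeriv_smul g X f }
  vbr := vbracketHom
  br := L.bracket
  rho :=
    { toFun := L.rho
      map_add' a b := by ext x; exact map_add (L.anchor x) (a x) (b x)
      map_smul' f a := by ext x; exact map_smul (L.anchor x) (f x) (a x) }
  nab :=
    { toFun X :=
        { toFun := covSec nab X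
          map_add' := covSec_add nab X
          map_smul' := covSec_const_smul nab X }
      map_add' X Y := by ext s x; exact map_add (nab s x) (X x) (Y x)
      map_smul' f X := by ext s x; exact map_smul (nab s x) (f x) (X x) }
  act :=
    { toFun := R.act
      map_add' := map_add R.act
      map_smul' f a := by ext1 s; exact R.smul_left f a s }
  der_vbr := vbracket_dirDeriv
  vbr_self := vbracket_self
  vbr_smul := vbracket_smul_right
  vbr_jacobi := vbracket_jacobi
  br_self := L.bracket_self
  br_smul := L.leibniz
  nab_smul := covSec_leibniz nab
  act_smul := R.leibniz

theorem invTheta_eq (a : Cₛ^∞⟮I; FA, A⟯) : invTheta nab R a = (algebroidCalculus nab R).theta a :=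
  rfl

theorem invT_eq (a : Cₛ^∞⟮I; FA, A⟯) (X : VField I M) :
    invT nab R a X = (algebroidCalculus nab R).tor a X := by
  ext1 s
  have h := map_sub ((algebroidCalculus nab R).nab X) (R.act a s) (covSec nab (L.rho a) s)
  rw [Calculus.tor_apply]
  change covSec nab X (R.act a s - covSec nab (L.rho a) s) -
    (R.act a (covSec nab X s) - covSec nab (L.rho a) (covSec nab X s)) -
    (covSec nab (L.rho a) (covSec nab X s) - covSec nab X (covSec nab (L.rho a) s) -
      covSec nab (vbracket (L.rho a) X) s) = covSec nab X (R.act a s) -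
      R.act a (covSec nab X s) + covSec nab (vbracket (L.rho a) X) s
  rw [show covSec nab X (R.act a s - covSec nab (L.rho a) s) = _ from h]
  change covSec nab X (R.act a s) - covSec nab X (covSec nab (L.rho a) s) - _ - _ = _
  abel

/-! Weil cochains as functions of lists. -/

section Represents

variable {p q : ℕ} {c : WeilSeq Cₛ^∞⟮I; FA, A⟯ (VField I M) Cₛ^∞⟮I; FV, V⟯ p q}
  {C : List Cₛ^∞⟮I; FA, A⟯ → List Cₛ^∞⟮I; FA, A⟯ → List (VField I M) → Cₛ^∞⟮I; FV, V⟯}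

theorem dWedgeNext_eq (h : Represents C c) (f : C^∞⟮I, M; ℝ⟯) (a k m : ℕ) (ha : a + (k + 1) = p)
    (hm : k + m = q) (α : Fin a → Cₛ^∞⟮I; FA, A⟯) (β : Fin (k + 1) → Cₛ^∞⟮I; FA, A⟯)
    (X : Fin m → VField I M) : dWedgeNext f c a k m ha hm α β X =
      (algebroidCalculus nab R).dWedge f (C (List.ofFn α) (List.ofFn β)) (List.ofFn X) := by
  cases m with
  | zero => rfl
  | succ m =>
    simp only [dWedgeNext, h a (k + 1) m]
    exact altSum_eq_altL (fun Y l => dirDeriv Y f • C (List.ofFn α) (List.ofFn β) l) X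

theorem isWeilCochain_of_represents (h : Represents C c)
    (hC : (algebroidCalculus nab R).ListWeil C) : IsWeilCochain c where
  form a k m ha hm α β := by
    have := (hC.form (List.ofFn α) (List.ofFn β)).isAlternating m
    simpa only [← h a k m ha hm] using this
  symm a k m ha hm α X := by
    have := (hC.symm (List.ofFn α) (List.ofFn X)).isSymmetric k
    simpa only [← h a k m ha hm] using this
  alt a k m ha hm β X := by
    have := (hC.alt (List.ofFn β) (List.ofFn X)).isAlternating a
    simpa only [← h a k m ha hm] using this
  leibniz a k m ha hm f α₀ α β X := by
    rw [dWedgeNext_eq nab R h, h, h, ofFn_cons, ofFn_cons, ofFn_cons]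
    exact hC.leibniz f α₀ _ _ _

theorem listWeil_listSeq (hc : IsWeilCochain c) :
    (algebroidCalculus nab R).ListWeil (listSeq c) where
  form α β := by
    by_cases h : α.length + β.length = p ∧ β.length ≤ q
    · obtain ⟨m, hm⟩ := Nat.exists_eq_add_of_le h.2
      refine isAlt_of_isAlternating (n := m) (fun X hX => listSeq_of_ne c (by omega)) ?_
      have e : (fun X : Fin m → VField I M => listSeq c α β (List.ofFn X)) =
          c _ _ m h.1 hm.symm α.get β.get := funext fun X => by
        simpa only [List.ofFn_get] using listSeq_ofFn c h.1 hm.symm α.get β.get X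
      rw [e]
      exact hc.form ..
    · have : listSeq c α β = fun _ => 0 := funext fun X => listSeq_of_ne c (by omega)
      rw [this]
      exact IsAlt.zero
  symm α X := by
    by_cases h : X.length ≤ q
    · obtain ⟨k, hk⟩ := Nat.exists_eq_add_of_le' h
      by_cases ha : α.length + k = p
      · refine isSym_of_isSymmetric (n := k) (fun β hβ => listSeq_of_ne c (by omega)) ?_
        have := hc.symm _ k _ ha hk.symm α.get X.get
        simpa only [← listSeq_ofFn c, List.ofFn_get] using this
      · have : (fun β => listSeq c α β X) = fun _ => 0 :=
          funext fun β => listSeq_of_ne c (by omega)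
        rw [this]
        exact IsSym.zero
    · have : (fun β => listSeq c α β X) = fun _ => 0 :=
        funext fun β => listSeq_of_ne c (by omega)
      rw [this]
      exact IsSym.zero
  alt β X := by
    by_cases h : β.length + X.length = q ∧ β.length ≤ p
    · obtain ⟨a, ha⟩ := Nat.exists_eq_add_of_le' h.2
      refine isAlt_of_isAlternating (n := a) (fun α hα => listSeq_of_ne c (by omega)) ?_
      have := hc.alt a _ _ ha.symm h.1 β.get X.get
      simpa only [← listSeq_ofFn c, List.ofFn_get] using this
    · have : (fun α => listSeq c α β X) = fun _ => 0 :=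
        funext fun β => listSeq_of_ne c (by omega)
      rw [this]
      exact IsAlt.zero
  leibniz f a α β X := by
    by_cases h : α.length + 1 + β.length = p ∧ β.length + X.length = q
    · have := hc.leibniz _ _ _ h.1 h.2 f a α.get β.get X.get
      rw [dWedgeNext_eq nab R (listSeq_represents c)] at this
      simpa only [← listSeq_ofFn c, ofFn_cons, List.ofFn_get] using this
    · have h1 : ∀ b, listSeq c (b :: α) β X = 0 := fun b => listSeq_of_ne c (by
        simpa only [List.length_cons] using h)
      have h2 : (algebroidCalculus nab R).dWedge f (listSeq c α (a :: β)) X =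
          altL (fun _ _ => 0) X := altL_congr fun Y X' hX => by
        rw [listSeq_of_ne c (by rw [List.length_cons]; omega), smul_zero]
      rw [h1, h1, h2, altL_zero, smul_zero, zero_add]

theorem represents_weilDelta (h : Represents C c) (hC : (algebroidCalculus nab R).ListWeil C) :
    Represents ((algebroidCalculus nab R).delta C) (weilDelta R c) := by
  intro a k m ha hm α β X
  rw [weilDelta, Calculus.delta, List.length_ofFn]
  congr 2
  · cases a with
    | zero => rfl
    | succ a =>
      have h1 := congrFun (congrFun (altSum_add_bracketSum (algebroidCalculus nab R).lieS
        (fun a b => L.bracket a b) (isAlt_pi.2 fun β => isAlt_pi.2 fun X => hC.alt β X) α)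
        (List.ofFn β)) (List.ofFn X)
      refine Eq.trans ?_ h1
      simp only [Pi.add_apply, altSum_apply, bracketSum_apply]
      simp only [deltaKoszul, h a k m]
      congr 2
      ext1 α₀
      ext1 α'
      rw [lieDer, Calculus.lieS_apply, Calculus.lieT, ← sum_update_eq_rep, ← sum_update_eq_rep,
        sub_right_comm]
      simp only [h a k m]
      rfl
  · cases k with
    | zero => rfl
    | succ k =>
      simp only [deltaContract, h a k (m + 1), ofFn_cons]
      exact sum_removeNth_eq_symL
        (fun b l => C (List.ofFn α) l (L.rho b :: List.ofFn X)) β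

theorem represents_weilCov (h : Represents C c) (hC : (algebroidCalculus nab R).ListWeil C) :
    Represents ((algebroidCalculus nab R).cov C) (weilCov nab c) := by
  intro a k m ha hm α β X
  rw [weilCov, Calculus.cov, List.length_ofFn]
  congr 2
  · cases m with
    | zero => rfl
    | succ m =>
      have h1 := altSum_add_bracketSum (algebroidCalculus nab R).nab
        vbracket (hC.form (List.ofFn α) (List.ofFn β)).restrict X
      refine Eq.trans ?_ h1
      have e : c a k m ha (by omega) α β = fun X => C (List.ofFn α) (List.ofFn β) (List.ofFn X) :=
        funext fun X => h ..
      simp only [covLead, extCov, e]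
      rfl
  · cases k with
    | zero => rfl
    | succ k =>
      simp only [covCorr, h (a + 1) k m, ofFn_cons]
      exact sum_removeNth_eq_symL (fun b l => C (b :: List.ofFn α) l (List.ofFn X)) β

theorem represents_weilWedge (h : Represents C c) :
    Represents ((algebroidCalculus nab R).wedge C)
      (weilWedge (invT nab R) (invTheta nab R) c) := by
  intro a k m ha hm α β X
  rw [weilWedge, Calculus.wedge]
  congr 1
  · cases a with
    | zero => rfl
    | succ a =>
      cases m with
      | zero => exact (altL_zero _).symm
      | succ m =>
        have e : ∀ a' α', altSum (fun Y X' => (algebroidCalculus nab R).tor a' Y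
            (C α' (List.ofFn β) (List.ofFn X'))) X = altL (fun Y l =>
              (algebroidCalculus nab R).tor a' Y (C α' (List.ofFn β) l)) (List.ofFn X) :=
          fun a' α' => altSum_eq_altL (fun Y l => (algebroidCalculus nab R).tor a' Y
            (C α' (List.ofFn β) l)) X
        simp only [wedgeLead, h a k m, invT_eq, e]
        exact altSum_eq_altL (fun a' l => altL (fun Y l' =>
          (algebroidCalculus nab R).tor a' Y (C l (List.ofFn β) l')) (List.ofFn X)) α
  · cases k with
    | zero => rfl
    | succ k =>
      simp only [wedgeCorr, h a k m, invTheta_eq]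
      exact sum_removeNth_eq_symL (fun b l =>
        (algebroidCalculus nab R).theta b (C (List.ofFn α) l (List.ofFn X))) β

end Represents

/-! The invariance form as a Weil cochain. -/

theorem isAlternating_zero {S N K : Type*} [CommRing K] [AddCommGroup S] [Module K S]
    [AddCommGroup N] [Module K N] (f : (Fin 0 → S) → N) : IsAlternating K f := by
  refine ⟨AlternatingMap.constOfIsEmpty K S (Fin 0) (f Fin.elim0), funext fun x => ?_⟩
  rw [AlternatingMap.constOfIsEmpty_apply]
  exact congrArg f (Subsingleton.elim _ _)

theorem isAlternating_one {S N K : Type*} [CommRing K] [AddCommGroup S] [Module K S]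
    [AddCommGroup N] [Module K N] {f : S → N} (hadd : ∀ x y, f (x + y) = f x + f y)
    (hsmul : ∀ (r : K) x, f (r • x) = r • f x) :
    IsAlternating K fun x : Fin 1 → S => f (x 0) :=
  ⟨AlternatingMap.ofSubsingleton K S N 0 { toFun := f, map_add' := hadd, map_smul' := hsmul }, rfl⟩

theorem IsAlternating.isSymmetric {S N K : Type*} [CommRing K] [AddCommGroup S] [Module K S]
    [AddCommGroup N] [Module K N] {m : ℕ} (hm : m ≤ 1) {f : (Fin m → S) → N}
    (hf : IsAlternating K f) : IsSymmetric K f := by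
  obtain ⟨g, hg⟩ := hf
  refine ⟨⟨g.toMultilinearMap, hg⟩, fun e x => congrArg f (funext fun i => ?_)⟩
  have : Subsingleton (Fin m) := Fin.subsingleton_iff_le_one.2 hm
  rw [Function.comp_apply, Subsingleton.elim (e i) i]

theorem isWeilCochain_pairSeq : IsWeilCochain (pairSeq (invT nab R) (invTheta nab R)) where
  form a k m ha hm α β := by
    obtain ⟨rfl, rfl, rfl⟩ | ⟨rfl, rfl, rfl⟩ :
        (a = 1 ∧ k = 0 ∧ m = 1) ∨ (a = 0 ∧ k = 1 ∧ m = 0) := by omega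
    · refine isAlternating_one (f := invT nab R (α 0)) (fun X Y => ?_) fun f X => ?_ <;>
        simp only [invT_eq] <;> ext1 s
      · exact (algebroidCalculus nab R).tor_add_right ..
      · exact (algebroidCalculus nab R).tor_smul_right ..
    · exact isAlternating_zero _
  symm a k m ha hm α X := by
    obtain ⟨rfl, rfl, rfl⟩ | ⟨rfl, rfl, rfl⟩ :
        (a = 1 ∧ k = 0 ∧ m = 1) ∨ (a = 0 ∧ k = 1 ∧ m = 0) := by omega
    · exact (isAlternating_zero _).isSymmetric zero_le_one
    · refine (isAlternating_one (f := invTheta nab R) (fun X Y => ?_) fun f X => ?_).isSymmetric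
        le_rfl <;> simp only [invTheta_eq] <;> ext1 s
      · exact (algebroidCalculus nab R).theta_add ..
      · exact (algebroidCalculus nab R).theta_smul ..
  alt a k m ha hm β X := by
    obtain ⟨rfl, rfl, rfl⟩ | ⟨rfl, rfl, rfl⟩ :
        (a = 1 ∧ k = 0 ∧ m = 1) ∨ (a = 0 ∧ k = 1 ∧ m = 0) := by omega
    · refine isAlternating_one (f := fun a => invT nab R a (X 0)) (fun a b => ?_) fun r a => ?_ <;>
        simp only [invT_eq] <;> ext1 s
      · exact (algebroidCalculus nab R).tor_add_left ..
      · exact (algebroidCalculus nab R).tor_restrict ..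
    · exact isAlternating_zero _
  leibniz a k m ha hm f α₀ α β X := by
    obtain ⟨rfl, rfl, rfl⟩ : a = 0 ∧ k = 0 ∧ m = 1 := by omega
    have h : invT nab R (f • α₀) (X 0) =
        f • invT nab R α₀ (X 0) + dirDeriv (X 0) f • invTheta nab R α₀ := by
      simp only [invT_eq, invTheta_eq]
      ext1 s
      exact (algebroidCalculus nab R).tor_smul_left ..
    refine h.trans ?_
    simp [dWedgeNext, altSum, pairSeq]

/-! Sections as Weil cochains of bidegree `(0, 0)`. -/

/-- A section of `V` as a sequence of bidegree `(0, 0)`. -/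
def sectionSeq (s : Cₛ^∞⟮I; FV, V⟯) :
    WeilSeq Cₛ^∞⟮I; FA, A⟯ (VField I M) Cₛ^∞⟮I; FV, V⟯ 0 0 := fun _ _ _ _ _ _ _ _ => s

theorem isWeilCochain_sectionSeq (s : Cₛ^∞⟮I; FV, V⟯) :
    IsWeilCochain (sectionSeq (FA := FA) (A := A) (I := I) s) where
  form a k m ha hm α β := by
    obtain ⟨rfl, rfl, rfl⟩ : a = 0 ∧ k = 0 ∧ m = 0 := by omega
    exact isAlternating_zero _
  symm a k m ha hm α X := by
    obtain ⟨rfl, rfl, rfl⟩ : a = 0 ∧ k = 0 ∧ m = 0 := by omega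
    exact (isAlternating_zero _).isSymmetric zero_le_one
  alt a k m ha hm β X := by
    obtain ⟨rfl, rfl, rfl⟩ : a = 0 ∧ k = 0 ∧ m = 0 := by omega
    exact isAlternating_zero _
  leibniz a k m ha hm f α₀ α β X := by omega

/-! The commutator. -/

theorem weilCov_weilDelta_sub {p q : ℕ}
    {c : WeilSeq Cₛ^∞⟮I; FA, A⟯ (VField I M) Cₛ^∞⟮I; FV, V⟯ p q} (hc : IsWeilCochain c) (a k m : ℕ)
    (ha : a + k = p + 1) (hm : k + m = q + 1) (α : Fin a → Cₛ^∞⟮I; FA, A⟯)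
    (β : Fin k → Cₛ^∞⟮I; FA, A⟯) (X : Fin m → VField I M) :
    weilCov nab (weilDelta R c) a k m ha hm α β X - weilDelta R (weilCov nab c) a k m ha hm α β X =
      weilWedge (invT nab R) (invTheta nab R) c a k m ha hm α β X := by
  have h := listSeq_represents c
  have hC := listWeil_listSeq nab R hc
  rw [represents_weilCov nab R (represents_weilDelta nab R h hC) (Calculus.delta_weil _ hC),
    represents_weilDelta nab R (represents_weilCov nab R h hC) (Calculus.cov_weil _ hC),
    represents_weilWedge nab R h]
  exact Calculus.cov_delta_sub_delta_cov _ hC _ _ _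

variable {nab R}

theorem invTheta_eq_zero_of_invariant (h : IsInvariantConnection nab R) (a : Cₛ^∞⟮I; FA, A⟯) :
    invTheta nab R a = 0 := by
  ext1 s
  exact sub_eq_zero.2 ((h a).1 s)

theorem invT_eq_zero_of_invariant (h : IsInvariantConnection nab R) (a : Cₛ^∞⟮I; FA, A⟯)
    (X : VField I M) : invT nab R a X = 0 := by
  rw [invT, (h a).2 X, invTheta_eq_zero_of_invariant h, sub_zero]
  ext1 s
  exact (sub_zero _).trans (map_zero ((algebroidCalculus nab R).nab X))

theorem invariant_of_invTheta_of_invT (hθ : ∀ a : Cₛ^∞⟮I; FA, A⟯, invTheta nab R a = 0)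
    (hT : ∀ (a : Cₛ^∞⟮I; FA, A⟯) (X : VField I M), invT nab R a X = 0) :
    IsInvariantConnection nab R := by
  refine fun a => ⟨fun s => sub_eq_zero.1 (LinearMap.congr_fun (hθ a) s), fun X => ?_⟩
  have h := hT a X
  rw [invT, hθ, sub_eq_zero] at h
  rw [← h]
  ext1 s
  exact (sub_zero _).trans (map_zero ((algebroidCalculus nab R).nab X))

theorem weilCov_weilDelta_of_invariant (h : IsInvariantConnection nab R) {p q : ℕ}
    {c : WeilSeq Cₛ^∞⟮I; FA, A⟯ (VField I M) Cₛ^∞⟮I; FV, V⟯ p q} (hc : IsWeilCochain c) :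
    weilCov nab (weilDelta R c) = weilDelta R (weilCov nab c) := by
  funext a k m ha hm α β X
  rw [← sub_eq_zero, weilCov_weilDelta_sub nab R hc,
    represents_weilWedge nab R (listSeq_represents c), Calculus.wedge]
  simp only [← invT_eq, ← invTheta_eq, invT_eq_zero_of_invariant h,
    invTheta_eq_zero_of_invariant h, LinearMap.zero_apply, altL_zero, symL_zero, add_zero]

theorem invariant_of_commute
    (h : ∀ (p q : ℕ) (c : WeilSeq Cₛ^∞⟮I; FA, A⟯ (VField I M) Cₛ^∞⟮I; FV, V⟯ p q),
      IsWeilCochain c → weilCov nab (weilDelta R c) = weilDelta R (weilCov nab c)) :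
    IsInvariantConnection nab R := by
  have h0 : ∀ (s : Cₛ^∞⟮I; FV, V⟯) a k m ha hm α β X,
      weilWedge (invT nab R) (invTheta nab R) (sectionSeq (FA := FA) (A := A) (I := I) s)
        a k m ha hm α β X = 0 := by
    intro s a k m ha hm α β X
    rw [← weilCov_weilDelta_sub nab R (isWeilCochain_sectionSeq s),
      h _ _ _ (isWeilCochain_sectionSeq s), sub_self]
  refine invariant_of_invTheta_of_invT (fun a => ?_) fun a X => ?_
  · ext1 s
    have := h0 s 0 1 0 rfl rfl Fin.elim0 (fun _ => a) Fin.elim0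
    simpa [weilWedge, wedgeLead, wedgeCorr, sectionSeq] using this
  · ext1 s
    have := h0 s 1 0 1 rfl rfl (fun _ => a) Fin.elim0 fun _ => X
    simpa [weilWedge, wedgeLead, wedgeCorr, sectionSeq, altSum] using this

theorem weilCov_eq_zero {p q : ℕ}
    {c : WeilSeq Cₛ^∞⟮I; FA, A⟯ (VField I M) Cₛ^∞⟮I; FV, V⟯ p q}
    (h : ∀ a k m ha hm α β X, c a k m ha hm α β X = 0) (R : AlgebroidRep FV V L) (a k m ha hm α β X) :
    weilCov nab c a k m ha hm α β X = 0 := by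
  have hc : Represents (fun _ _ _ => 0) c := h
  have h0 : (algebroidCalculus nab R).ListWeil fun _ _ _ => 0 :=
    ⟨fun _ _ => IsAlt.zero, fun _ _ => IsSym.zero, fun _ _ => IsAlt.zero, fun f a α β X => by
      simp only [Calculus.dWedge, smul_zero, altL_zero, add_zero]⟩
  rw [represents_weilCov nab R hc h0, Calculus.cov, Calculus.cor, symL_zero, sub_zero,
    Calculus.dCov, kos_zero, smul_zero]

end Algebroid

end LieAlgebroidWeil

end

theorem mainTheorem2
    {E : Type*} [NormedAddCommGroup E] [NormedSpace ℝ E] [FiniteDimensional ℝ E]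
    {H : Type*} [TopologicalSpace H] {I : ModelWithCorners ℝ E H}
    {M : Type*} [TopologicalSpace M] [ChartedSpace H M] [IsManifold I ∞ M]
    [BoundarylessManifold I M] [T2Space M] [SecondCountableTopology M]
    {FA : Type*} [NormedAddCommGroup FA] [NormedSpace ℝ FA] [FiniteDimensional ℝ FA]
    {A : M → Type*} [TopologicalSpace (TotalSpace FA A)] [∀ x, TopologicalSpace (A x)]
    [∀ x, AddCommGroup (A x)] [∀ x, Module ℝ (A x)]
    [FiberBundle FA A] [VectorBundle ℝ FA A] [ContMDiffVectorBundle ∞ FA A I]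
    {FV : Type*} [NormedAddCommGroup FV] [NormedSpace ℝ FV] [FiniteDimensional ℝ FV]
    {V : M → Type*} [TopologicalSpace (TotalSpace FV V)] [∀ x, TopologicalSpace (V x)]
    [∀ x, AddCommGroup (V x)] [∀ x, Module ℝ (V x)]
    [∀ x, IsTopologicalAddGroup (V x)] [∀ x, ContinuousSMul ℝ (V x)]
    [FiberBundle FV V] [VectorBundle ℝ FV V] [ContMDiffVectorBundle ∞ FV V I]
    (L : LieAlgebroid I FA A) (R : AlgebroidRep FV V L)
    (nab : CovariantDerivative I FV V) [nab.ContMDiffCovariantDerivative ∞] :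
    -- the operators take Weil cochains to Weil cochains
    (∀ (p q : ℕ) (c : WeilSeq Cₛ^∞⟮I; FA, A⟯ (VField I M)
        Cₛ^∞⟮I; FV, V⟯ p q), IsWeilCochain c →
      IsWeilCochain (weilCov nab c) ∧
      IsWeilCochain (weilDelta R c) ∧
      IsWeilCochain (weilWedge
        (invT nab R) (invTheta nab R) c)) ∧
    -- `(T, θ)` is a Weil cochain with values in `End V`
    IsWeilCochain (pairSeq
      (invT nab R) (invTheta nab R)) ∧
    -- the commutator formula
    (∀ (p q : ℕ) (c : WeilSeq Cₛ^∞⟮I; FA, A⟯ (VField I M)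
        Cₛ^∞⟮I; FV, V⟯ p q), IsWeilCochain c →
      ∀ a k m (ha : a + k = p + 1) (hm : k + m = q + 1) (α : Fin a → Cₛ^∞⟮I; FA, A⟯)
        (β : Fin k → Cₛ^∞⟮I; FA, A⟯) (X : Fin m → VField I M),
      weilCov nab (weilDelta R c) a k m ha hm α β X -
          weilDelta R (weilCov nab c) a k m ha hm α β X =
        weilWedge (invT nab R) (invTheta nab R) c a k m ha hm α β X) ∧
    -- `d^∇` is a cochain map if and only if the connection is `A`-invariant
    ((∀ (p q : ℕ) (c : WeilSeq Cₛ^∞⟮I; FA, A⟯ (VField I M)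
        Cₛ^∞⟮I; FV, V⟯ p q), IsWeilCochain c →
      weilCov nab (weilDelta R c) =
        weilDelta R (weilCov nab c)) ↔
      IsInvariantConnection nab R) ∧
    -- in that case `d^∇` maps infinitesimal multiplicative forms to such forms
    (IsInvariantConnection nab R →
      ∀ (q : ℕ) (c : WeilSeq Cₛ^∞⟮I; FA, A⟯ (VField I M)
        Cₛ^∞⟮I; FV, V⟯ 1 q), IsWeilCochain c →
      (∀ a k m ha hm α β X, weilDelta R c a k m ha hm α β X = 0) →
      ∀ a k m ha hm α β X, weilDelta R (weilCov nab c) a k m ha hm α β X = 0) := by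
  refine ⟨fun p q c hc => ?_, isWeilCochain_pairSeq nab R, fun p q c hc => ?_,
    ⟨invariant_of_commute, fun h p q c hc => weilCov_weilDelta_of_invariant h hc⟩,
    fun h q c hc hz a k m ha hm α β X => ?_⟩
  · have hr := listSeq_represents c
    have hC := listWeil_listSeq nab R hc
    exact ⟨isWeilCochain_of_represents nab R (represents_weilCov nab R hr hC)
        (Calculus.cov_weil _ hC),
      isWeilCochain_of_represents nab R (represents_weilDelta nab R hr hC)
        (Calculus.delta_weil _ hC),
      isWeilCochain_of_represents nab R (represents_weilWedge nab R hr)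
        (Calculus.wedge_weil _ hC)⟩
  · exact weilCov_weilDelta_sub nab R hc
  · rw [← weilCov_weilDelta_of_invariant h hc]
    exact weilCov_eq_zero hz R ..
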